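/- Let $k$ be a field and let $H$ be a finite-dimensional Hopf algebra over $k$ with comultiplication $\Delta(h)=h_{(1)}\otimes h_{(2)}$ and antipode $S$ (which is bijective, since $\dim_k H<\infty$). Let $\star$ be the convolution product on $\mathrm{End}_k(H)$, $(f\star g)(h)=f(h_{(1)})g(h_{(2)})$. The identity map is $\star$-invertible with inverse $S$, so $\mathrm{id}_H^{\star m}$ is defined for all $m\in\mathbb Z$. The Kashina–Montgomery–Ng indicator of $H$ is $\nu_n^{\mathrm{KMN}}(H)=\mathrm{Tr}\bigl(S\circ \mathrm{id}_H^{\star(n-1)}\bigr)$ for $n\in\mathbb Z$. Let $\mathcal C$ be a $k$-linear left rigid monoidal category with finite-dimensional Hom spaces, unit object $\mathbf 1$, and duals $V^*$ with $\mathrm{ev}_V:V^*\otimes V\to\mathbf 1$, $\mathrm{coev}_V:\mathbf 1\to V\otimes V^*$. A pivotal object of $\mathcal C$ is a pair $\mathbf V=(V,\phi)$ with $V\in\mathcal C$ and $\phi:V\to V^{**}$ an isomorphism; its dual is $\mathbf V^*=(V^*,(\phi^*)^{-1})$. For $n\ge 1$ put $V^{\otimes n}=V\otimes(V\otimes(\cdots\otimes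 V))$ and let $E^{(n)}_{\mathbf V}$ be the $k$-linear automorphism of $\mathrm{Hom}_{\mathcal C}(\mathbf 1,V^{\otimes n})$ given as follows. For $n\ge 2$ it is the composition of the duality isomorphisms $\mathrm{Hom}(\mathbf 1,V\otimes V^{\otimes(n-1)})\cong \mathrm{Hom}(V^*,V^{\otimes(n-1)})\cong \mathrm{Hom}(\mathbf 1,V^{\otimes(n-1)}\otimes V^{**})$ with composition by $\mathrm{id}\otimes\phi^{-1}$ and the associativity isomorphism $V^{\otimes(n-1)}\otimes V\cong V^{\otimes n}$. For $n=1$, $E^{(1)}_{\mathbf V}(f)=\phi^{-1}\circ f^{**}\circ\delta_0$ with $\delta_0:\mathbf 1\to\mathbf 1^{**}$ the canonical isomorphism. For $n=0$, $E^{(0)}_{\mathbf V}:\mathrm{End}(\mathbf 1)\to\mathrm{End}(\mathbf 1)$ is $f\mapsto \bigl(\mathrm{ev}_V\circ(\mathrm{id}_{V^*}\otimes\phi^{-1})\circ\mathrm{coev}_{V^*}\bigr)\circ f$. The $(n,r)$-th Frobenius–Schur indicator is $\nu_{n,r}(\mathbf V)=\mathrm{Tr}\bigl((E^{(n)}_{\mathbf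 V})^r\bigr)$ for $n>0$, $r\in\mathbb Z$ and for $n=0$, $r\ge 0$; it is extended to the remaining pairs ($n<0$, or $n=0$ and $r<0$) by $\nu_{n,r}(\mathbf V)=\nu_{-n,-r}(\mathbf V^*)$. Let $\mathcal C$ be the category of finite-dimensional left $H$-modules, with $H$ acting on $V\otimes_k W$ through $\Delta$ and on $V^*=\mathrm{Hom}_k(V,k)$ by $(h f)(x)=f(S(h)x)$, and let $\mathbf R_H=(H,\phi)$, where $H$ is the left regular module and $\phi:H\to H^{**}$, $\langle\phi(h),p\rangle=\langle p,S^2(h)\rangle$ for $h\in H$, $p\in H^*$. **Theorem.** For all integers $n$, $$\nu_n^{\mathrm{KMN}}(H)=\nu_{n,1}(\mathbf R_H^*).$$ -/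

import Mathlib

open CategoryTheory MonoidalCategory

noncomputable section

namespace FSIndicator

section General

universe v u

variable {C : Type u} [Category.{v} C] [MonoidalCategory C] [RightRigidCategory C]

/-! Duals `V*` are those with `ev : V* ⊗ V ⟶ 𝟙` and `coev : 𝟙 ⟶ V ⊗ V*`. They are often called
left duals; in Mathlib they are called right duals. -/

/-- The chosen dual `V*` of `V`. -/
def dual (V : C) : C := Vᘁ

def ev (V : C) : dual V ⊗ V ⟶ 𝟙_ C := ε_ V (Vᘁ)

def coev (V : C) : 𝟙_ C ⟶ V ⊗ dual V := η_ V (Vᘁ)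

instance exactPairingDual (V : C) : ExactPairing V (dual V) :=
  inferInstanceAs (ExactPairing V (Vᘁ))

/-- The dual `f* : W* ⟶ V*` of a morphism `f : V ⟶ W`. -/
def dualMap {V W : C} (f : V ⟶ W) : dual W ⟶ dual V := rightAdjointMate f

theorem dualMap_id (V : C) : dualMap (𝟙 V) = 𝟙 (dual V) := rightAdjointMate_id

theorem dualMap_comp {U V W : C} (f : U ⟶ V) (g : V ⟶ W) :
    dualMap (f ≫ g) = dualMap g ≫ dualMap f := comp_rightAdjointMate

/-- For an isomorphism `e : V ⟶ W`, the isomorphism `(e*)⁻¹ = (e⁻¹)* : V* ⟶ W*`. -/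
def dualIso {V W : C} (e : V ≅ W) : dual V ≅ dual W where
  hom := dualMap e.inv
  inv := dualMap e.hom
  hom_inv_id := by rw [← dualMap_comp, e.hom_inv_id, dualMap_id]
  inv_hom_id := by rw [← dualMap_comp, e.inv_hom_id, dualMap_id]

variable (C) in
/-- An object of the pivotal cover: an object `V` with an isomorphism `φ : V ≅ V**`. -/
structure PivotalObject where
  obj : C
  φ : obj ≅ dual (dual obj)

/-- The dual `(V*, (φ*)⁻¹)` of a pivotal object `(V, φ)`. -/
def PivotalObject.dual (V : PivotalObject C) : PivotalObject C where
  obj := FSIndicator.dual V.obj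
  φ := dualIso V.φ

/-- The tensor power `V ⊗ (V ⊗ (⋯ ⊗ (V ⊗ V)))` with `n` factors. -/
def tensorPow (V : C) : ℕ → C
  | 0 => 𝟙_ C
  | 1 => V
  | n + 2 => V ⊗ tensorPow V (n + 1)

/-- The reassociation isomorphism `V^{⊗(n+1)} ⊗ V ≅ V^{⊗(n+2)}`. -/
def tensorPowAssoc (V : C) : (n : ℕ) → (tensorPow V (n + 1) ⊗ V ≅ tensorPow V (n + 2))
  | 0 => Iso.refl _
  | n + 1 => α_ V (tensorPow V (n + 1)) V ≪≫ whiskerLeftIso V (tensorPowAssoc V n)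

variable (C) in
/-- The canonical isomorphism `𝟙 ≅ 𝟙*`. -/
def dualUnitIso : 𝟙_ C ≅ dual (𝟙_ C) :=
  rightDualIso exactPairingUnit (exactPairingDual (𝟙_ C))

variable (C) in
/-- The unit constraint `𝟙 ≅ 𝟙**` of the monoidal functor `(-)**`. -/
def doubleDualUnitIso : 𝟙_ C ≅ dual (dual (𝟙_ C)) :=
  dualUnitIso C ≪≫ dualIso (dualUnitIso C)

/-- The left pivotal dimension `ev_V ∘ (id ⊗ φ⁻¹) ∘ coev_{V*}` of `(V, φ)`. -/
def leftDim (V : PivotalObject C) : 𝟙_ C ⟶ 𝟙_ C :=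
  coev (dual V.obj) ≫ dual V.obj ◁ V.φ.inv ≫ ev V.obj

theorem dualMap_bijective (V W : C) :
    Function.Bijective (dualMap : (V ⟶ W) → (dual W ⟶ dual V)) := by
  have h : ∀ f : V ⟶ W, dualMap f =
      (((λ_ V).homCongr (Iso.refl W)).symm.trans ((tensorRightHomEquiv _ V (dual V) _).trans
        ((tensorLeftHomEquiv _ W (dual W) _).symm.trans
          ((ρ_ (dual W)).homCongr (Iso.refl (dual V)))))) f := by
    intro f
    have h1 := tensorRightHomEquiv_symm_coevaluation_comp_whiskerRight (Y' := dual V) f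
    have h2 := tensorLeftHomEquiv_symm_coevaluation_comp_whiskerRight f
    simp only [Equiv.trans_apply, Iso.homCongr_symm, Iso.homCongr_apply, Iso.symm_inv,
      Iso.refl_symm, Iso.refl_hom, Category.comp_id]
    rw [← h1, Equiv.apply_symm_apply, Iso.eq_inv_comp]
    exact h2.symm
  rw [show (dualMap : (V ⟶ W) → (dual W ⟶ dual V)) = _ from funext h]
  exact Equiv.bijective _

variable (k : Type*) [Field k] [Preadditive C] [Linear k C] [MonoidalPreadditive C]
  [MonoidalLinear k C]

def dualMapLinear (V W : C) : (V ⟶ W) →ₗ[k] (dual W ⟶ dual V) where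
  toFun := dualMap
  map_add' f g := by
    have h : (f + g)ᘁ = fᘁ + gᘁ := by simp [rightAdjointMate]
    exact h
  map_smul' c f := by
    have h : (c • f)ᘁ = c • fᘁ := by simp [rightAdjointMate]
    exact h

def dualMapEquiv (V W : C) : (V ⟶ W) ≃ₗ[k] (dual W ⟶ dual V) :=
  LinearEquiv.ofBijective (dualMapLinear k V W) (dualMap_bijective V W)

/-- `Hom(V* ⊗ X, W) ≅ Hom(X, V ⊗ W)`. -/
def homLeftEquiv (V X W : C) : (dual V ⊗ X ⟶ W) ≃ₗ[k] (X ⟶ V ⊗ W) where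
  __ := tensorLeftHomEquiv X V (dual V) W
  map_add' f g := by simp [tensorLeftHomEquiv]
  map_smul' c f := by simp [tensorLeftHomEquiv]

/-- `Hom(X ⊗ V, W) ≅ Hom(X, W ⊗ V*)`. -/
def homRightEquiv (V X W : C) : (X ⊗ V ⟶ W) ≃ₗ[k] (X ⟶ W ⊗ dual V) where
  __ := tensorRightHomEquiv X V (dual V) W
  map_add' f g := by simp [tensorRightHomEquiv]
  map_smul' c f := by simp [tensorRightHomEquiv]

/-- The isomorphism `Hom(𝟙, V ⊗ W) ≅ Hom(V*, W) ≅ Hom(𝟙, W ⊗ V**)`. -/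
def rotate (V W : C) : (𝟙_ C ⟶ V ⊗ W) ≃ₗ[k] (𝟙_ C ⟶ W ⊗ dual (dual V)) :=
  (homLeftEquiv k V (𝟙_ C) W).symm ≪≫ₗ
    Linear.homCongr k (ρ_ (dual V) ≪≫ (λ_ (dual V)).symm) (Iso.refl W) ≪≫ₗ
    homRightEquiv k (dual V) (𝟙_ C) W

/-- The map `E^{(0)}` on `End(𝟙)`: composition with the left pivotal dimension. -/
def indicatorMapZero (V : PivotalObject C) : (𝟙_ C ⟶ 𝟙_ C) →ₗ[k] (𝟙_ C ⟶ 𝟙_ C) :=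
  Linear.rightComp k (𝟙_ C) (leftDim V)

/-- The automorphism `E^{(n+1)}` of `Hom(𝟙, V^{⊗(n+1)})`. For `n = 0` it is
`f ↦ φ⁻¹ ∘ f** ∘ δ` with `δ : 𝟙 ≅ 𝟙**`; for `n + 1` in place of `n` it is the rotation
`Hom(𝟙, V ⊗ V^{⊗(n+1)}) ≅ Hom(𝟙, V^{⊗(n+1)} ⊗ V**)` followed by `id ⊗ φ⁻¹` and reassociation. -/
def indicatorMap (V : PivotalObject C) :
    (n : ℕ) → ((𝟙_ C ⟶ tensorPow V.obj (n + 1)) ≃ₗ[k] (𝟙_ C ⟶ tensorPow V.obj (n + 1)))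
  | 0 => dualMapEquiv k (𝟙_ C) V.obj ≪≫ₗ dualMapEquiv k (dual V.obj) (dual (𝟙_ C)) ≪≫ₗ
      Linear.homCongr k (doubleDualUnitIso C).symm V.φ.symm
  | n + 1 => rotate k V.obj (tensorPow V.obj (n + 1)) ≪≫ₗ
      Linear.homCongr k (Iso.refl (𝟙_ C))
        (whiskerLeftIso (tensorPow V.obj (n + 1)) V.φ.symm ≪≫ tensorPowAssoc V.obj n)

/-- The `(n, r)`-th Frobenius-Schur indicator `ν_{n,r}(V)` of a pivotal object: the trace of
`(E^{(n)})^r` if `n > 0`, or if `n = 0` and `r ≥ 0`; in the remaining cases it is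
given by `ν_{n,r}(V) = ν_{-n,-r}(V*)`. -/
def indicator [∀ X Y : C, FiniteDimensional k (X ⟶ Y)] (n r : ℤ) (V : PivotalObject C) : k :=
  match n with
  | .ofNat 0 =>
      if 0 ≤ r then LinearMap.trace k (𝟙_ C ⟶ 𝟙_ C) (indicatorMapZero k V ^ r.toNat)
      else LinearMap.trace k (𝟙_ C ⟶ 𝟙_ C) (indicatorMapZero k V.dual ^ (-r).toNat)
  | .ofNat (m + 1) => LinearMap.trace k (𝟙_ C ⟶ tensorPow V.obj (m + 1))
      (indicatorMap k V m ^ r).toLinearMap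
  | .negSucc m => LinearMap.trace k (𝟙_ C ⟶ tensorPow V.dual.obj (m + 1))
      (indicatorMap k V.dual m ^ (-r)).toLinearMap

theorem indicatorMap_zero_apply (V : PivotalObject C) (f : 𝟙_ C ⟶ V.obj) :
    indicatorMap k V 0 f =
      ((doubleDualUnitIso C).hom ≫ dualMap (dualMap f)) ≫ V.φ.inv := rfl

theorem indicatorMap_succ_apply (V : PivotalObject C) (n : ℕ)
    (f : 𝟙_ C ⟶ tensorPow V.obj (n + 2)) :
    indicatorMap k V (n + 1) f =
      (𝟙 _ ≫ rotate k V.obj (tensorPow V.obj (n + 1)) f) ≫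
        tensorPow V.obj (n + 1) ◁ V.φ.inv ≫ (tensorPowAssoc V.obj n).hom := rfl

end General

section Representations

open TensorProduct Coalgebra

variable {k H : Type*} [Field k] [Ring H] [HopfAlgebra k H]
variable {U V W : Type*} [AddCommGroup U] [Module k U] [AddCommGroup V] [Module k V]
  [AddCommGroup W] [Module k W]

/-- The tensor product of representations, `h • (v ⊗ w) = h₁ • v ⊗ h₂ • w`. -/
def tensorRep (ρ : H →ₐ[k] Module.End k V) (σ : H →ₐ[k] Module.End k W) :
    H →ₐ[k] Module.End k (V ⊗[k] W) :=
  (Module.endTensorEndAlgHom.comp (Algebra.TensorProduct.map ρ σ)).comp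
    (Bialgebra.comulAlgHom k H)

variable (k H) in
/-- The trivial representation, `h • c = ε(h) c`. -/
def unitRep : H →ₐ[k] Module.End k k :=
  (Algebra.lmul k k).comp (Bialgebra.counitAlgHom k H)

/-- The dual representation, `(h • f)(x) = f(S(h) • x)`. -/
def dualRep (ρ : H →ₐ[k] Module.End k V) : H →ₐ[k] Module.End k (Module.Dual k V) :=
  AlgHom.ofLinearMap
    (Module.Dual.transpose ∘ₗ ρ.toLinearMap ∘ₗ HopfAlgebra.antipode k)
    (by ext; simp [Module.Dual.transpose])
    (fun a b => by
      ext; simp [Module.Dual.transpose, HopfAlgebra.antipode_mul_antidistrib])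

theorem dualRep_apply (ρ : H →ₐ[k] Module.End k V) (h : H) (f : Module.Dual k V) (x : V) :
    dualRep ρ h f x = f (ρ (HopfAlgebra.antipode k h) x) := rfl

theorem unitRep_apply (h : H) (c : k) : unitRep k H h c = counit (R := k) h * c := rfl

theorem tensorRep_apply (ρ : H →ₐ[k] Module.End k V) (σ : H →ₐ[k] Module.End k W)
    (h : H) {ι : Type*} (r : Coalgebra.Repr k h ι) :
    tensorRep ρ σ h =
      ∑ i ∈ r.index, TensorProduct.map (ρ (r.left i)) (σ (r.right i)) := by
  simp only [tensorRep, AlgHom.comp_apply, Bialgebra.comulAlgHom_apply]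
  rw [← r.eq]
  simp only [map_sum, Algebra.TensorProduct.map_tmul]
  rfl

theorem tensorRep_assoc (τ : H →ₐ[k] Module.End k U) (ρ : H →ₐ[k] Module.End k V)
    (σ : H →ₐ[k] Module.End k W) (h : H) :
    (TensorProduct.assoc k U V W).toLinearMap ∘ₗ tensorRep (tensorRep τ ρ) σ h =
      tensorRep τ (tensorRep ρ σ) h ∘ₗ (TensorProduct.assoc k U V W).toLinearMap := by
  let r := ℛ k h
  rw [tensorRep_apply _ _ h r, tensorRep_apply _ _ h r]
  simp only [fun i => tensorRep_apply τ ρ _ (ℛ k (r.left i)),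
    fun i => tensorRep_apply ρ σ _ (ℛ k (r.right i))]
  have key := Coalgebra.sum_tmul_tmul_eq r (fun i => ℛ k (r.left i)) (fun i => ℛ k (r.right i))
  refine TensorProduct.ext_threefold fun x y z => ?_
  have := congrArg (TensorProduct.map (LinearMap.applyₗ x ∘ₗ τ.toLinearMap)
    (TensorProduct.map (LinearMap.applyₗ y ∘ₗ ρ.toLinearMap)
      (LinearMap.applyₗ z ∘ₗ σ.toLinearMap))) key
  simpa [TensorProduct.sum_tmul, TensorProduct.tmul_sum, LinearMap.sum_apply] using this

theorem tensorRep_lid (ρ : H →ₐ[k] Module.End k V) (h : H) :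
    (TensorProduct.lid k V).toLinearMap ∘ₗ tensorRep (unitRep k H) ρ h =
      ρ h ∘ₗ (TensorProduct.lid k V).toLinearMap := by
  let r := ℛ k h
  rw [tensorRep_apply _ _ h r]
  refine TensorProduct.ext' fun c x => ?_
  have := congrArg (fun a => c • ρ a x) (Coalgebra.sum_counit_smul r)
  simp only [map_sum, map_smul, LinearMap.sum_apply, LinearMap.smul_apply, Finset.smul_sum] at this
  simp [unitRep_apply, mul_smul, ← this, smul_comm c]

theorem tensorRep_rid (ρ : H →ₐ[k] Module.End k V) (h : H) :
    (TensorProduct.rid k V).toLinearMap ∘ₗ tensorRep ρ (unitRep k H) h =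
      ρ h ∘ₗ (TensorProduct.rid k V).toLinearMap := by
  let r := ℛ k h
  rw [tensorRep_apply _ _ h r]
  refine TensorProduct.ext' fun x c => ?_
  have h1 : ∑ i ∈ r.index, counit (R := k) (r.right i) • r.left i = h := by
    have := congrArg (TensorProduct.rid k H) (Coalgebra.sum_tmul_counit_eq r)
    simpa only [map_sum, TensorProduct.rid_tmul, one_smul] using this
  have := congrArg (fun a => c • ρ a x) h1
  simp only [map_sum, map_smul, LinearMap.sum_apply, LinearMap.smul_apply, Finset.smul_sum] at this
  simp [unitRep_apply, mul_smul, ← this, smul_comm c]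

theorem tensorRep_map {V' W' : Type*} [AddCommGroup V'] [Module k V'] [AddCommGroup W']
    [Module k W'] {ρ : H →ₐ[k] Module.End k V} {σ : H →ₐ[k] Module.End k W}
    {ρ' : H →ₐ[k] Module.End k V'} {σ' : H →ₐ[k] Module.End k W'}
    (f : V →ₗ[k] V') (g : W →ₗ[k] W') (hf : ∀ h : H, f ∘ₗ ρ h = ρ' h ∘ₗ f)
    (hg : ∀ h : H, g ∘ₗ σ h = σ' h ∘ₗ g) (h : H) :
    TensorProduct.map f g ∘ₗ tensorRep ρ σ h =
      tensorRep ρ' σ' h ∘ₗ TensorProduct.map f g := by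
  rw [tensorRep_apply _ _ h (ℛ k h), tensorRep_apply _ _ h (ℛ k h)]
  refine TensorProduct.ext' fun x y => ?_
  have h1 := fun a => LinearMap.congr_fun (hf a) x
  have h2 := fun a => LinearMap.congr_fun (hg a) y
  simp only [LinearMap.comp_apply] at h1 h2
  simp [h1, h2]

theorem tensorRep_contractLeft (ρ : H →ₐ[k] Module.End k V) (h : H) :
    contractLeft k V ∘ₗ tensorRep (dualRep ρ) ρ h = unitRep k H h ∘ₗ contractLeft k V := by
  let r := ℛ k h
  rw [tensorRep_apply _ _ h r]
  refine TensorProduct.ext' fun f x => ?_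
  have := congrArg (fun a => f (ρ a x)) (HopfAlgebra.sum_antipode_mul_eq_smul (R := k) r)
  simp only [map_sum, map_mul, map_smul, map_one, LinearMap.sum_apply, LinearMap.smul_apply,
    Module.End.mul_apply, Module.End.one_apply] at this
  simp [unitRep_apply, contractLeft_apply, dualRep_apply, this]

theorem tensorRep_coevaluation [FiniteDimensional k V] (ρ : H →ₐ[k] Module.End k V) (h : H) :
    coevaluation k V ∘ₗ unitRep k H h = tensorRep ρ (dualRep ρ) h ∘ₗ coevaluation k V := by
  let r := ℛ k h
  let b := Module.Basis.ofVectorSpace k V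
  rw [tensorRep_apply _ _ h r]
  apply LinearMap.ext_ring
  let e := (TensorProduct.comm k V (Module.Dual k V)).trans (dualTensorHomEquiv k V V)
  have he : ∀ (v : V) (f : Module.Dual k V) (x : V), e (v ⊗ₜ f) x = f x • v := fun v f x => by
    simp [e, dualTensorHom_apply]
  apply e.injective
  ext x
  have h1 : ∀ y : V, ∑ i, b.coord i y • b i = y := fun y => b.sum_repr y
  have h2 := congrArg (fun a => ρ a x) (HopfAlgebra.sum_mul_antipode_eq_smul (R := k) r)
  simp only [map_sum, map_mul, map_smul, map_one, LinearMap.sum_apply, LinearMap.smul_apply,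
    Module.End.mul_apply, Module.End.one_apply] at h2
  have h3 : ∀ i, ∑ j, (b.coord j) (ρ (HopfAlgebra.antipode k (r.right i)) x) •
      ρ (r.left i) (b j) = ρ (r.left i) (ρ (HopfAlgebra.antipode k (r.right i)) x) := fun i => by
    conv_rhs => rw [← h1 (ρ (HopfAlgebra.antipode k (r.right i)) x)]
    simp only [map_sum, map_smul]
  have lhs : (coevaluation k V ∘ₗ unitRep k H h) 1 = counit (R := k) h • coevaluation k V 1 := by
    rw [← map_smul, LinearMap.comp_apply, unitRep_apply, smul_eq_mul]
  rw [lhs, LinearMap.comp_apply, coevaluation_apply_one]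
  simp only [map_sum, map_smul, LinearMap.sum_apply, TensorProduct.map_tmul, LinearMap.smul_apply,
    he, dualRep_apply]
  rw [h1 x, Finset.sum_comm]
  exact h2.symm.trans (Finset.sum_congr rfl fun i _ => (h3 i).symm)

end Representations

section Modules

universe u

variable (k H : Type u) [Field k] [Ring H] [HopfAlgebra k H]

open TensorProduct Coalgebra

/-- A finite-dimensional left `H`-module: a finite-dimensional `k`-vector space with an algebra
map from `H` to its linear endomorphisms. -/
structure HMod where
  carrier : Type u
  [addCommGroup : AddCommGroup carrier]
  [module : Module k carrier]
  [finite : FiniteDimensional k carrier]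
  ρ : H →ₐ[k] Module.End k carrier

attribute [instance] HMod.addCommGroup HMod.module HMod.finite

namespace HMod

variable {k H}

/-- The space of `H`-linear maps. -/
def homs (V W : HMod k H) : Submodule k (V.carrier →ₗ[k] W.carrier) where
  carrier := {f | ∀ h : H, f ∘ₗ V.ρ h = W.ρ h ∘ₗ f}
  add_mem' {f g} hf hg h := by
    rw [LinearMap.add_comp, LinearMap.comp_add, hf h, hg h]
  zero_mem' h := by simp
  smul_mem' c f hf h := by
    rw [LinearMap.smul_comp, LinearMap.comp_smul, hf h]

instance : Category (HMod k H) where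
  Hom V W := homs V W
  id V := ⟨LinearMap.id, fun _ => rfl⟩
  comp f g := ⟨g.1 ∘ₗ f.1, fun h => by
    rw [LinearMap.comp_assoc, f.2 h, ← LinearMap.comp_assoc, g.2 h, LinearMap.comp_assoc]⟩

/-- The linear map underlying a morphism. -/
def lin {V W : HMod k H} (f : V ⟶ W) : V.carrier →ₗ[k] W.carrier := f.1

/-- An `H`-linear map as a morphism. -/
def ofLin {V W : HMod k H} (f : V.carrier →ₗ[k] W.carrier)
    (hf : ∀ h : H, f ∘ₗ V.ρ h = W.ρ h ∘ₗ f) : V ⟶ W := ⟨f, hf⟩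

theorem lin_comm {V W : HMod k H} (f : V ⟶ W) (h : H) : lin f ∘ₗ V.ρ h = W.ρ h ∘ₗ lin f := f.2 h

theorem hom_ext {V W : HMod k H} {f g : V ⟶ W} (h : lin f = lin g) : f = g := Subtype.ext h

@[simp] theorem lin_ofLin {V W : HMod k H} (f : V.carrier →ₗ[k] W.carrier)
    (hf : ∀ h : H, f ∘ₗ V.ρ h = W.ρ h ∘ₗ f) : lin (ofLin f hf) = f := rfl

@[simp] theorem lin_id (V : HMod k H) : lin (𝟙 V) = LinearMap.id := rfl

@[simp] theorem lin_comp {U V W : HMod k H} (f : U ⟶ V) (g : V ⟶ W) :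
    lin (f ≫ g) = lin g ∘ₗ lin f := rfl

/-- An `H`-linear equivalence as an isomorphism. -/
def mkIso {V W : HMod k H} (e : V.carrier ≃ₗ[k] W.carrier)
    (he : ∀ h : H, e.toLinearMap ∘ₗ V.ρ h = W.ρ h ∘ₗ e.toLinearMap) : V ≅ W where
  hom := ofLin e.toLinearMap he
  inv := ofLin e.symm.toLinearMap fun h => by
    ext x
    apply e.injective
    have := LinearMap.congr_fun (he h) (e.symm x)
    simpa using this.symm
  hom_inv_id := hom_ext (by ext; simp)
  inv_hom_id := hom_ext (by ext; simp)

instance : Preadditive (HMod k H) where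
  homGroup V W := inferInstanceAs (AddCommGroup (homs V W))
  add_comp _ _ _ _ _ _ := Subtype.ext (LinearMap.comp_add _ _ _)
  comp_add _ _ _ _ _ _ := Subtype.ext (LinearMap.add_comp _ _ _)

instance : Linear k (HMod k H) where
  homModule V W := inferInstanceAs (Module k (homs V W))
  smul_comp _ _ _ _ _ _ := Subtype.ext (LinearMap.comp_smul _ _ _)
  comp_smul _ _ _ _ _ _ := Subtype.ext (LinearMap.smul_comp _ _ _)

@[simp] theorem lin_add {V W : HMod k H} (f g : V ⟶ W) : lin (f + g) = lin f + lin g := rfl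

@[simp] theorem lin_smul {V W : HMod k H} (c : k) (f : V ⟶ W) : lin (c • f) = c • lin f := rfl

instance (V W : HMod k H) : FiniteDimensional k (V ⟶ W) :=
  inferInstanceAs (FiniteDimensional k (homs V W))

instance : MonoidalCategory (HMod k H) where
  tensorObj V W := ⟨V.carrier ⊗[k] W.carrier, tensorRep V.ρ W.ρ⟩
  tensorUnit := ⟨k, unitRep k H⟩
  tensorHom f g := ofLin (TensorProduct.map (lin f) (lin g))
    (tensorRep_map _ _ (lin_comm f) (lin_comm g))
  whiskerLeft U _ _ f := ofLin ((lin f).lTensor U.carrier)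
    (tensorRep_map LinearMap.id _ (fun _ => rfl) (lin_comm f))
  whiskerRight f U := ofLin ((lin f).rTensor U.carrier)
    (tensorRep_map _ LinearMap.id (lin_comm f) (fun _ => rfl))
  associator U V W := mkIso (TensorProduct.assoc k U.carrier V.carrier W.carrier)
    (tensorRep_assoc U.ρ V.ρ W.ρ)
  leftUnitor V := mkIso (TensorProduct.lid k V.carrier) (tensorRep_lid V.ρ)
  rightUnitor V := mkIso (TensorProduct.rid k V.carrier) (tensorRep_rid V.ρ)
  tensorHom_def _ _ := hom_ext (TensorProduct.ext' fun _ _ => rfl)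
  id_tensorHom_id _ _ := hom_ext (TensorProduct.ext' fun _ _ => rfl)
  tensorHom_comp_tensorHom _ _ _ _ := hom_ext (TensorProduct.ext' fun _ _ => rfl)
  whiskerLeft_id _ _ := hom_ext (TensorProduct.ext' fun _ _ => rfl)
  id_whiskerRight _ _ := hom_ext (TensorProduct.ext' fun _ _ => rfl)
  associator_naturality _ _ _ := hom_ext (TensorProduct.ext_threefold fun _ _ _ => rfl)
  leftUnitor_naturality f := hom_ext (TensorProduct.ext' fun c x => ((lin f).map_smul c x).symm)
  rightUnitor_naturality f := hom_ext (TensorProduct.ext' fun x c => ((lin f).map_smul c x).symm)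
  pentagon _ _ _ _ := hom_ext (TensorProduct.ext_fourfold fun _ _ _ _ => rfl)
  triangle _ _ := hom_ext (TensorProduct.ext_threefold fun x c y =>
    (TensorProduct.smul_tmul c x y).symm)

instance : MonoidalPreadditive (HMod k H) where
  whiskerLeft_zero := hom_ext (LinearMap.lTensor_zero _)
  zero_whiskerRight := hom_ext (LinearMap.rTensor_zero _)
  whiskerLeft_add _ _ := hom_ext (LinearMap.lTensor_add _ _ _)
  add_whiskerRight _ _ := hom_ext (LinearMap.rTensor_add _ _ _)

instance : MonoidalLinear k (HMod k H) where
  whiskerLeft_smul _ _ _ c f := hom_ext (LinearMap.lTensor_smul _ c (lin f))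
  smul_whiskerRight c _ _ f _ := hom_ext (LinearMap.rTensor_smul _ c (lin f))

/-- The dual module. -/
def dualModule (V : HMod k H) : HMod k H := ⟨Module.Dual k V.carrier, dualRep V.ρ⟩

instance (V : HMod k H) : ExactPairing V (dualModule V) where
  coevaluation' := ofLin (coevaluation k V.carrier) (tensorRep_coevaluation V.ρ)
  evaluation' := ofLin (contractLeft k V.carrier) (tensorRep_contractLeft V.ρ)
  coevaluation_evaluation' := hom_ext (contractLeft_assoc_coevaluation k V.carrier)
  evaluation_coevaluation' := hom_ext (contractLeft_assoc_coevaluation' k V.carrier)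

instance : RightRigidCategory (HMod k H) where
  rightDual V := { rightDual := dualModule V }

variable (k H) in
/-- The left regular module. -/
def regular [FiniteDimensional k H] : HMod k H := ⟨H, Algebra.lmul k H⟩

end HMod

end Modules

section Antipode

open TensorProduct Coalgebra HopfAlgebra

variable {k H : Type*} [Field k] [Ring H] [HopfAlgebra k H]

theorem sum_counit_right_smul {h : H} {ι : Type*} (r : Coalgebra.Repr k h ι) :
    ∑ i ∈ r.index, counit (R := k) (r.right i) • r.left i = h := by
  have := congrArg (TensorProduct.rid k H) (Coalgebra.sum_tmul_counit_eq r)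
  simpa only [map_sum, TensorProduct.rid_tmul, one_smul] using this

/-! The antipode of a finite-dimensional Hopf algebra is bijective. -/

theorem freeMap_surjective {V : Type*} [AddCommGroup V] [Module k V]
    (ρ : H →ₐ[k] Module.End k V) :
    Function.Surjective (TensorProduct.lift ((LinearMap.lcomp k (H ⊗[k] V)
      (TensorProduct.mk k H V 1)).comp (tensorRep (Algebra.lmul k H) ρ).toLinearMap)) := by
  intro t
  induction t using TensorProduct.induction_on with
  | zero => exact ⟨0, map_zero _⟩
  | add x y hx hy =>
    obtain ⟨a, rfl⟩ := hx
    obtain ⟨b, rfl⟩ := hy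
    exact ⟨a + b, map_add _ _ _⟩
  | tmul h v =>
    let r := ℛ k h
    refine ⟨∑ i ∈ r.index, r.left i ⊗ₜ ρ (antipode k (r.right i)) v, ?_⟩
    have key := Coalgebra.sum_tmul_tmul_eq r (fun i => ℛ k (r.left i)) (fun i => ℛ k (r.right i))
    have key2 := congrArg (LinearMap.lTensor H (LinearMap.applyₗ v ∘ₗ ρ.toLinearMap ∘ₗ
      LinearMap.mul' k H ∘ₗ (antipode k).lTensor H)) key
    have key3 : ∀ i, ∑ j ∈ (ℛ k (r.right i)).index, ρ ((ℛ k (r.right i)).left j)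
        (ρ (antipode k ((ℛ k (r.right i)).right j)) v) = counit (R := k) (r.right i) • v := by
      intro i
      have := congrArg (fun a => ρ a v)
        (sum_mul_antipode_eq_smul (R := k) (ℛ k (r.right i)))
      simpa [LinearMap.sum_apply] using this
    have key4 := congrArg (fun a => a ⊗ₜ[k] v) (sum_counit_right_smul r)
    simp only [TensorProduct.sum_tmul, TensorProduct.smul_tmul] at key4
    simp [← TensorProduct.tmul_sum, key3] at key2
    simp [fun i => tensorRep_apply (Algebra.lmul k H) ρ _ (ℛ k (r.left i)), LinearMap.sum_apply]
    rw [key2, ← key4]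
    simp

theorem one_tmul_mul_comul {Λ : H} (hΛ : ∀ g : H, g * Λ = counit (R := k) g • Λ) (g : H) :
    ((1 : H) ⊗ₜ[k] g) * comul Λ = (antipode k g ⊗ₜ[k] (1 : H)) * comul Λ := by
  let r := ℛ k g
  have h1 : ∑ i ∈ r.index, (antipode k (r.left i) ⊗ₜ[k] (1 : H)) * comul (r.right i) =
      (1 : H) ⊗ₜ[k] g := by
    have key := Coalgebra.sum_tmul_tmul_eq r (fun i => ℛ k (r.left i)) (fun i => ℛ k (r.right i))
    have key2 := congrArg ((LinearMap.mul' k H ∘ₗ (antipode k).rTensor H).rTensor H ∘ₗ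
      (TensorProduct.assoc k H H H).symm.toLinearMap) key
    have key3 : ∀ i, ∑ j ∈ (ℛ k (r.left i)).index, antipode k ((ℛ k (r.left i)).left j) *
        (ℛ k (r.left i)).right j = counit (R := k) (r.left i) • 1 := fun i =>
      sum_antipode_mul_eq_smul (R := k) (ℛ k (r.left i))
    have key4 : ∀ i, comul (R := k) (r.right i) = ∑ j ∈ (ℛ k (r.right i)).index,
      (ℛ k (r.right i)).left j ⊗ₜ[k] (ℛ k (r.right i)).right j := fun i => (ℛ k (r.right i)).eq.symm
    simp only [key4, Finset.mul_sum, Algebra.TensorProduct.tmul_mul_tmul, one_mul]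
    simp only [map_sum, LinearMap.comp_apply, LinearEquiv.coe_coe, TensorProduct.assoc_symm_tmul,
      LinearMap.rTensor_tmul, LinearMap.mul'_apply, ← TensorProduct.sum_tmul, key3] at key2
    rw [← key2]
    simp only [TensorProduct.smul_tmul, ← TensorProduct.tmul_sum, Coalgebra.sum_counit_smul r]
  rw [← h1, Finset.sum_mul]
  simp only [mul_assoc, ← Bialgebra.comul_mul, hΛ, map_smul]
  conv_rhs => rw [← sum_counit_right_smul r]
  simp only [map_sum, map_smul, TensorProduct.sum_tmul, Finset.sum_mul, mul_smul_comm,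
    ← TensorProduct.smul_tmul', smul_mul_assoc]

variable [FiniteDimensional k H]

theorem exists_leftIntegral :
    ∃ Λ : H, Λ ≠ 0 ∧ ∀ g : H, g * Λ = counit (R := k) g • Λ := by
  let ρ : H →ₐ[k] Module.End k (Module.Dual k H) := dualRep (Algebra.lmul k H)
  let B := TensorProduct.lift ((LinearMap.lcomp k (H ⊗[k] Module.Dual k H)
      (TensorProduct.mk k H (Module.Dual k H) 1)).comp
        (tensorRep (Algebra.lmul k H) ρ).toLinearMap)
  have hsurj : Function.Surjective B := freeMap_surjective ρ
  have hinj : Function.Injective B := LinearMap.injective_iff_surjective.mpr hsurj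
  have heq : ∀ (g : H) (s), B ((LinearMap.mulLeft k g).rTensor _ s) =
      tensorRep (Algebra.lmul k H) ρ g (B s) := by
    intro g s
    induction s using TensorProduct.induction_on with
    | zero => simp
    | add x y hx hy => simp only [map_add, hx, hy]
    | tmul h v => simp [B]
  let t := coevaluation k H 1
  have ht : t ≠ 0 := by
    intro h0
    have := LinearMap.congr_fun (contractLeft_assoc_coevaluation' k H) ((1 : k) ⊗ₜ (1 : H))
    simp only [LinearMap.comp_apply, LinearMap.rTensor_tmul, LinearEquiv.coe_coe] at this
    rw [show coevaluation k H 1 = 0 from h0] at this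
    have h1 := congrArg (counit (R := k)) (congrArg (TensorProduct.rid k H) this)
    simp at h1
  obtain ⟨s, hs⟩ := hsurj t
  have hinv : ∀ g : H, (LinearMap.mulLeft k g).rTensor _ s = counit (R := k) g • s := by
    intro g
    apply hinj
    rw [heq, map_smul, hs]
    have := LinearMap.congr_fun (tensorRep_coevaluation (Algebra.lmul k H) g) 1
    rw [LinearMap.comp_apply, LinearMap.comp_apply, unitRep_apply, ← smul_eq_mul, map_smul] at this
    exact this.symm
  let b := Module.Basis.ofVectorSpace k (Module.Dual k H)
  classical
  let E := TensorProduct.equivFinsuppOfBasisRight (M := H) b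
  have hs0 : E s ≠ 0 := by
    intro h0
    apply ht
    rw [← hs, (LinearEquiv.map_eq_zero_iff E).mp h0, map_zero]
  obtain ⟨i, hi⟩ := Finsupp.ne_iff.mp hs0
  refine ⟨E s i, hi, fun g => ?_⟩
  have hE : ∀ s, E ((LinearMap.mulLeft k g).rTensor _ s) i = g * E s i := by
    intro s
    induction s using TensorProduct.induction_on with
    | zero => simp
    | add x y hx hy => simp only [map_add, Finsupp.add_apply, hx, hy, mul_add]
    | tmul h v => simp [E]
  rw [← hE, hinv, map_smul, Finsupp.smul_apply]

theorem antipode_injective : Function.Injective (antipode k : H →ₗ[k] H) := by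
  obtain ⟨Λ, hΛ0, hΛ⟩ := exists_leftIntegral (k := k) (H := H)
  rw [injective_iff_map_eq_zero]
  intro h hh
  obtain ⟨f, hf⟩ : ∃ f : Module.Dual k H, f Λ ≠ 0 := by
    by_contra! hc
    exact hΛ0 ((Module.forall_dual_apply_eq_zero_iff k Λ).mp hc)
  let b := Module.Basis.ofVectorSpace k H
  let r := ℛ k Λ
  let L : H →ₗ[k] H := (TensorProduct.lid k H).toLinearMap ∘ₗ
    TensorProduct.map f (antipode k) ∘ₗ comul
  have hzero : ∀ a c, h * a * (∑ i ∈ r.index, b.coord c (r.left i) • r.right i) = 0 := by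
    intro a c
    have h1 := one_tmul_mul_comul hΛ (h * a)
    rw [antipode_mul_antidistrib, hh, mul_zero, TensorProduct.zero_tmul, zero_mul, ← r.eq] at h1
    have h2 := congrArg ((TensorProduct.lid k H).toLinearMap ∘ₗ (b.coord c).rTensor H) h1
    simp only [Finset.mul_sum, Algebra.TensorProduct.tmul_mul_tmul, one_mul, map_sum,
      LinearMap.comp_apply, LinearMap.rTensor_tmul, LinearEquiv.coe_coe, TensorProduct.lid_tmul,
      map_zero] at h2
    simpa only [Finset.mul_sum, mul_smul_comm] using h2
  have hL : ∑ i ∈ r.index, h * L (r.left i) * r.right i = 0 := by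
    have h1 : ∀ i, h * L (r.left i) * r.right i =
        ∑ c, h * L (b c) * (b.coord c (r.left i) • r.right i) := by
      intro i
      conv_lhs => rw [← b.sum_repr (r.left i)]
      simp only [map_sum, map_smul, Finset.mul_sum, Finset.sum_mul, mul_smul_comm, smul_mul_assoc,
        Module.Basis.coord_apply]
    simp only [h1]
    rw [Finset.sum_comm]
    simp only [← Finset.mul_sum, hzero, Finset.sum_const_zero]
  have key := Coalgebra.sum_tmul_tmul_eq r (fun i => ℛ k (r.left i)) (fun i => ℛ k (r.right i))
  have key2 := congrArg ((TensorProduct.lid k H).toLinearMap ∘ₗ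
    TensorProduct.map f (LinearMap.mul' k H ∘ₗ (antipode k).rTensor H)) key
  have key3 : ∀ i, ∑ j ∈ (ℛ k (r.right i)).index, antipode k ((ℛ k (r.right i)).left j) *
      (ℛ k (r.right i)).right j = counit (R := k) (r.right i) • 1 := fun i =>
    sum_antipode_mul_eq_smul (R := k) (ℛ k (r.right i))
  have key4 : ∀ i, L (r.left i) = ∑ j ∈ (ℛ k (r.left i)).index,
      f ((ℛ k (r.left i)).left j) • antipode k ((ℛ k (r.left i)).right j) := by
    intro i
    simp only [L, LinearMap.comp_apply]
    rw [← (ℛ k (r.left i)).eq]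
    simp
  have key5 : ∑ i ∈ r.index, L (r.left i) * r.right i = f Λ • 1 := by
    simp only [map_sum, LinearMap.comp_apply, TensorProduct.map_tmul, LinearMap.rTensor_tmul,
      LinearMap.mul'_apply, LinearEquiv.coe_coe, TensorProduct.lid_tmul, ← Finset.smul_sum,
      key3] at key2
    simp only [key4, Finset.sum_mul, smul_mul_assoc]
    rw [key2]
    conv_rhs => rw [← sum_counit_right_smul r]
    simp only [map_sum, map_smul, Finset.sum_smul]
    exact Finset.sum_congr rfl fun i _ => by rw [smul_smul, smul_eq_mul, mul_comm]
  have h5 := congrArg (h * ·) key5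
  simp only [Finset.mul_sum, ← mul_assoc, hL, mul_smul_comm, mul_one] at h5
  exact (smul_eq_zero.mp h5.symm).resolve_left hf

theorem antipode_bijective : Function.Bijective (antipode k : H →ₗ[k] H) :=
  ⟨antipode_injective, LinearMap.injective_iff_surjective.mp antipode_injective⟩

end Antipode

section Regular

universe u

variable (k H : Type u) [Field k] [Ring H] [HopfAlgebra k H]

open HopfAlgebra

/-- The identity of `H` as an invertible element of the convolution algebra `End_k(H)`,
with inverse the antipode. -/
def convId : (WithConv (H →ₗ[k] H))ˣ where
  val := WithConv.toConv LinearMap.id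
  inv := WithConv.toConv (antipode k)
  val_inv := LinearMap.id_mul_antipode
  inv_val := LinearMap.antipode_mul_id

/-- The Kashina-Montgomery-Ng indicator: the trace of `S ∘ id^{⋆(n-1)}`, where `⋆` is the
convolution product. -/
def kmnIndicator (n : ℤ) : k :=
  LinearMap.trace k H (antipode k ∘ₗ ((convId k H ^ (n - 1)).val).ofConv)

variable [FiniteDimensional k H]

/-- The antipode of a finite-dimensional Hopf algebra as a linear automorphism. -/
def antipodeEquiv : H ≃ₗ[k] H := LinearEquiv.ofBijective (antipode k) antipode_bijective

/-- The linear isomorphism `φ : H → H**` given by `⟨φ(h), p⟩ = ⟨p, S²(h)⟩`. -/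
def regularEquiv : H ≃ₗ[k] Module.Dual k (Module.Dual k H) :=
  (antipodeEquiv k H ≪≫ₗ antipodeEquiv k H) ≪≫ₗ Module.evalEquiv k H

theorem regularEquiv_apply (h : H) (p : Module.Dual k H) :
    regularEquiv k H h p = p (antipode k (antipode k h)) := rfl

theorem regularEquiv_comm (a : H) :
    (regularEquiv k H).toLinearMap ∘ₗ Algebra.lmul k H a =
      dualRep (dualRep (Algebra.lmul k H)) a ∘ₗ (regularEquiv k H).toLinearMap := by
  ext h p
  simp [regularEquiv_apply, dualRep_apply, antipode_mul_antidistrib]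

/-- The pivotal object `R_H = (H, φ)`, where `H` is the left regular module. -/
def regularPivotal : PivotalObject (HMod k H) where
  obj := HMod.regular k H
  φ := HMod.mkIso (regularEquiv k H) (regularEquiv_comm k H)

end Regular

end FSIndicator

end

universe u

noncomputable section

namespace FSIndicator

/-! ### The rotation operators $E^{(n)}$ as linear algebra on underlying vector spaces. -/

section Linearization

open TensorProduct Coalgebra HopfAlgebra FSIndicator.HMod

variable {k H : Type u} [Field k] [Ring H] [HopfAlgebra k H]

namespace HMod

/-! A morphism from the unit is its value at $1$, an invariant vector. On invariants $E^{(n)}$ is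
the twisted cyclic shift $v\otimes w\mapsto w\otimes\psi(v)$, where
$\psi=\phi^{-1}\circ\mathrm{eval}$ is `pivotMap`. Each trace is computed by parametrizing the
invariants of $V^{\otimes n}$ by $V^{\otimes(n-1)}$ and then using cyclicity of the trace to remove
one tensor factor at a time.

For $n\ge2$ and $V=H^*$, the invariants are $\sum_i b_iw\otimes b^i$ for dual bases $b_i,b^i$, and
$w$ is recovered by evaluating the last factor at $1$. Here $\psi$ is the transpose of $S^2$ and
$S^2(1)=1$, so $E^{(n)}$ becomes $w\mapsto$ the contraction of the first factor of $\sum_i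
b_iw\otimes b^i$ with $1$. By `trace_contractHead_appendTail` its trace is $\sum_i\langle
b^i,S(\mathrm{id}^{\star(n-1)}(b_i))\rangle$, the required one. For $n=1$ both sides are $1$; for
$n=0$ both are $\mathrm{Tr}(S^2)$.

For $n=-m<0$ the object is $H^{**}\cong H$, with $\psi=S^{-2}$, and the operator is the inverse of
$E^{(m)}$. Take a left integral $\Lambda$ of $H$ and a right integral $l$ of $H^*$ with
$l(\Lambda)=1$. For $m\ge2$ the invariants are $\Lambda_1\otimes\Lambda_2w$, with $w$ recovered by
contracting the first factor with $l$. By `trace_contractTail_consHead` the trace is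
$l(S^2(\Lambda_m\cdots\Lambda_1))=l(S(S^{\star m}(\Lambda)))$. The trace formula
$\mathrm{Tr}(f)=l(S(\Lambda_2)f(\Lambda_1))$ (`IsIntegralPair.trace_eq_sum`) gives the same value
for $\mathrm{Tr}(S\circ S^{\star(m+1)})$. For $m=1$ the invariants are $k\Lambda$ and both sides are
$l(S^2(\Lambda))$. -/

theorem hom_unit_ext {V : HMod k H} {f g : 𝟙_ (HMod k H) ⟶ V}
    (h : lin f (1 : k) = lin g (1 : k)) : f = g :=
  hom_ext (LinearMap.ext_ring h)

/-- The canonical map `V → V**`. -/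
def doubleDualEval (V : HMod k H) : V.carrier →ₗ[k] (dual (dual V)).carrier :=
  Module.Dual.eval k V.carrier

theorem sum_coord_smul {V : Type*} [AddCommGroup V] [Module k V] {ι : Type*} [Fintype ι]
    (b : Module.Basis ι k V) (p : Module.Dual k V) : ∑ i, p (b i) • b.coord i = p := by
  refine b.ext fun j => ?_
  classical
  simp

/-- Expansion of $\mathrm{eval}(x)\in V^{**}$ in the basis dual to a basis of $V^*$. This is what
collapses the coevaluation sum in the rotation to a flip of tensor factors. -/
theorem sum_contract_tmul_coord {V W : Type*} [AddCommGroup V] [Module k V] [AddCommGroup W]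
    [Module k W] {ι : Type*} [Fintype ι] (b : Module.Basis ι k (Module.Dual k V)) (t : V ⊗[k] W) :
    ∑ i, TensorProduct.lid k W (LinearMap.rTensor W (b i) t) ⊗ₜ[k] b.coord i =
      (Module.Dual.eval k V).lTensor W (TensorProduct.comm k V W t) := by
  induction t using TensorProduct.induction_on with
  | zero => simp
  | add x y hx hy => simp only [map_add, TensorProduct.add_tmul, Finset.sum_add_distrib, hx, hy]
  | tmul x y =>
    simp only [LinearMap.rTensor_tmul, TensorProduct.lid_tmul, TensorProduct.comm_tmul,
      LinearMap.lTensor_tmul, TensorProduct.smul_tmul, ← TensorProduct.tmul_sum]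
    exact congrArg (y ⊗ₜ[k] ·) (sum_coord_smul b (Module.Dual.eval k V x))

/-- By cyclicity the trace may be taken on $V^{**}$, in the basis dual to the one that defines the
coevaluation of $V^*$. -/
theorem contractLeft_lTensor_coevaluation_dual {V : Type*} [AddCommGroup V] [Module k V]
    [FiniteDimensional k V] (T : Module.Dual k (Module.Dual k V) →ₗ[k] V) :
    contractLeft k V (T.lTensor (Module.Dual k V) (coevaluation k (Module.Dual k V) 1)) =
      LinearMap.trace k V (T ∘ₗ Module.Dual.eval k V) := by
  classical
  let b := Module.Basis.ofVectorSpace k (Module.Dual k V)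
  rw [LinearMap.trace_comp_comm', LinearMap.trace_eq_matrix_trace k b.dualBasis]
  simp [coevaluation_apply_one, Matrix.trace, LinearMap.toMatrix_apply, b]

/-- Identifies the categorical mate with the ordinary transpose, by evaluating its zigzag on a
basis. -/
theorem lin_dualMap_apply {V W : HMod k H} (f : V ⟶ W) (p : Module.Dual k W.carrier) :
    lin (dualMap f) p = p ∘ₗ lin f := by
  have : lin (dualMap f) p = ∑ i, p (lin f ((Module.Basis.ofVectorSpace k V.carrier) i)) •
      (Module.Basis.ofVectorSpace k V.carrier).coord i := by
    change TensorProduct.lid k (Module.Dual k V.carrier) (LinearMap.rTensor _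
      (contractLeft k W.carrier) ((TensorProduct.assoc k _ _ _).symm (LinearMap.lTensor _
        (LinearMap.rTensor _ (lin f)) (p ⊗ₜ[k] (coevaluation k V.carrier 1))))) = _
    simp [coevaluation_apply_one, TensorProduct.tmul_sum]
  rw [this]
  exact sum_coord_smul _ (p ∘ₗ lin f)

theorem lin_dualUnitIso_inv (p : Module.Dual k k) :
    lin (dualUnitIso (HMod k H)).inv p = p 1 := by
  change (TensorProduct.lid k k) (LinearMap.rTensor _
      (contractLeft k k) ((TensorProduct.assoc k _ _ _).symm (LinearMap.lTensor _
        (LinearMap.rTensor _ LinearMap.id) (p ⊗ₜ[k] ((1 : k) ⊗ₜ[k] (1 : k)))))) = _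
  simp

/-- Deduced from the inverse, which is explicit and sends the identity functional to $1$. -/
theorem lin_dualUnitIso_hom :
    lin (dualUnitIso (HMod k H)).hom (1 : k) = (LinearMap.id : Module.Dual k k) := by
  have h1 := lin_dualUnitIso_inv (H := H) (LinearMap.id : Module.Dual k k)
  generalize dualUnitIso (HMod k H) = e at h1 ⊢
  have h2 : lin e.hom (lin e.inv (LinearMap.id : Module.Dual k k)) =
      (LinearMap.id : Module.Dual k k) :=
    congrArg (fun f => lin f (LinearMap.id : Module.Dual k k)) e.inv_hom_id
  exact (congrArg (lin e.hom) h1.symm).trans h2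

theorem lin_homLeftEquiv_symm (V W : HMod k H) (f : 𝟙_ (HMod k H) ⟶ V ⊗ W)
    (p : Module.Dual k V.carrier) (c : k) :
    lin ((homLeftEquiv k V (𝟙_ _) W).symm f) (p ⊗ₜ[k] c) =
      TensorProduct.lid k W.carrier (LinearMap.rTensor W.carrier p (lin f c)) := by
  change TensorProduct.lid k W.carrier (LinearMap.rTensor _ (contractLeft k V.carrier)
    ((TensorProduct.assoc k _ _ _).symm (p ⊗ₜ[k] (lin f c)))) = _
  congr 1
  generalize lin f c = t
  change V.carrier ⊗[k] W.carrier at t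
  induction t using TensorProduct.induction_on with
  | zero => simp
  | add x y hx hy => simp only [TensorProduct.tmul_add, map_add, hx, hy]
  | tmul x y => simp

theorem lin_homRightEquiv_one (V W : HMod k H) (f : 𝟙_ (HMod k H) ⊗ V ⟶ W) :
    lin (homRightEquiv k V (𝟙_ _) W f) (1 : k) =
      ∑ i, lin f ((1 : k) ⊗ₜ[k] (Module.Basis.ofVectorSpace k V.carrier i)) ⊗ₜ[k]
        (Module.Basis.ofVectorSpace k V.carrier).coord i := by
  change LinearMap.rTensor _ (lin f) ((TensorProduct.assoc k _ _ _).symm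
    ((1 : k) ⊗ₜ[k] coevaluation k V.carrier 1)) = _
  simp [coevaluation_apply_one, TensorProduct.tmul_sum]

theorem lin_rotate_one (V W : HMod k H) (f : 𝟙_ (HMod k H) ⟶ V ⊗ W) :
    lin (rotate k V W f) (1 : k) =
      (doubleDualEval V).lTensor W.carrier (TensorProduct.comm k V.carrier W.carrier
        (lin f (1 : k))) := by
  change lin (homRightEquiv k (dual V) (𝟙_ _) W _) (1 : k) = _
  rw [lin_homRightEquiv_one]
  have : ∀ p : Module.Dual k V.carrier, lin
      ((Linear.homCongr k (ρ_ (dual V) ≪≫ (λ_ (dual V)).symm) (Iso.refl W))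
        ((homLeftEquiv k V (𝟙_ _) W).symm f)) ((1 : k) ⊗ₜ[k] p) =
      TensorProduct.lid k W.carrier (LinearMap.rTensor W.carrier p (lin f (1 : k))) := by
    intro p
    rw [← lin_homLeftEquiv_symm]
    change lin ((homLeftEquiv k V (𝟙_ _) W).symm f) (((1 : k) • p) ⊗ₜ[k] (1 : k)) = _
    rw [one_smul]
  exact (Finset.sum_congr rfl fun i _ => congrArg (· ⊗ₜ[k] _) (this _)).trans
    (sum_contract_tmul_coord _ _)

/-- The linear endomorphism `φ⁻¹ ∘ eval` of the space underlying a pivotal object `(V, φ)`. -/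
def pivotMap (V : PivotalObject (HMod k H)) : V.obj.carrier →ₗ[k] V.obj.carrier :=
  lin V.φ.inv ∘ₗ doubleDualEval V.obj

/-- The unit constraint sends $1$ to evaluation at $1$, and $f^{**}$ is a double transpose, so
together they give $\mathrm{eval}(f(1))$. -/
theorem lin_indicatorMap_zero_one (V : PivotalObject (HMod k H)) (f : 𝟙_ (HMod k H) ⟶ V.obj) :
    lin (indicatorMap k V 0 f) (1 : k) = pivotMap V (lin f (1 : k)) := by
  rw [indicatorMap_zero_apply]
  change lin V.φ.inv (lin (dualMap (dualMap f)) (lin (doubleDualUnitIso (HMod k H)).hom (1 : k)))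
    = lin V.φ.inv _
  congr 1
  have h : lin (doubleDualUnitIso (HMod k H)).hom (1 : k) =
      Module.Dual.eval k k 1 := by
    change lin (dualMap (dualUnitIso (HMod k H)).inv) (lin (dualUnitIso (HMod k H)).hom (1 : k)) = _
    refine (lin_dualMap_apply _ _).trans ?_
    refine LinearMap.ext fun p => ?_
    exact (congrArg (fun q : Module.Dual k k => q (lin (dualUnitIso (HMod k H)).inv p))
      lin_dualUnitIso_hom).trans (lin_dualUnitIso_inv p)
  rw [h]
  refine (lin_dualMap_apply _ _).trans ?_
  refine LinearMap.ext fun p => ?_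
  exact congrArg (fun q : Module.Dual k k => q 1) (lin_dualMap_apply f p)

theorem lin_indicatorMap_succ_one (V : PivotalObject (HMod k H)) (n : ℕ)
    (f : 𝟙_ (HMod k H) ⟶ tensorPow V.obj (n + 2)) :
    lin (indicatorMap k V (n + 1) f) (1 : k) = lin (tensorPowAssoc V.obj n).hom
      ((pivotMap V).lTensor (tensorPow V.obj (n + 1)).carrier (TensorProduct.comm k V.obj.carrier
        (tensorPow V.obj (n + 1)).carrier (lin f (1 : k)))) := by
  rw [indicatorMap_succ_apply]
  change lin (tensorPowAssoc V.obj n).hom ((lin V.φ.inv).lTensor (tensorPow V.obj (n + 1)).carrier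
    (lin (rotate k V.obj (tensorPow V.obj (n + 1)) f) (1 : k))) = _
  have := lin_rotate_one V.obj (tensorPow V.obj (n + 1)) f
  rw [pivotMap, LinearMap.lTensor_comp]
  exact congrArg (fun x => lin (tensorPowAssoc V.obj n).hom
    ((lin V.φ.inv).lTensor (tensorPow V.obj (n + 1)).carrier x)) this

theorem lin_leftDim_one (V : PivotalObject (HMod k H)) :
    lin (leftDim V) (1 : k) = LinearMap.trace k V.obj.carrier (pivotMap V) := by
  exact contractLeft_lTensor_coevaluation_dual (lin V.φ.inv)

end HMod
end Linearization

/-! ### Convolution powers of the identity with reversed multiplication. -/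

section OpposedConvolutionPowers

open TensorProduct Coalgebra

variable {k H : Type*} [Field k] [Ring H] [HopfAlgebra k H]

/-- The map `h ↦ hₙ₊₁ ⋯ h₂h₁`. -/
def opConvPow : ℕ → H →ₗ[k] H
  | 0 => LinearMap.id
  | n + 1 => LinearMap.mul' k H ∘ₗ TensorProduct.map (opConvPow n) LinearMap.id ∘ₗ
      (TensorProduct.comm k H H).toLinearMap ∘ₗ comul

theorem opConvPow_succ_apply (n : ℕ) {h : H} {ι : Type*} (r : Coalgebra.Repr k h ι) :
    opConvPow (k := k) (n + 1) h = ∑ i ∈ r.index, opConvPow (k := k) n (r.right i) * r.left i := by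
  simp [opConvPow, ← r.eq]

end OpposedConvolutionPowers

/-! ### Traces of operators that insert at one end of a tensor power and contract at the other. -/

section TensorPowers

open TensorProduct Coalgebra HopfAlgebra FSIndicator.HMod

variable {k H : Type u} [Field k] [Ring H] [HopfAlgebra k H]

namespace HMod

variable (V : HMod k H) (n : ℕ)

/-- The contraction `V ⊗ V^{⊗(n+1)} → V^{⊗(n+1)}` of the first factor with a functional. -/
def contractHead (ξ : Module.Dual k V.carrier) :
    (tensorPow V (n + 2)).carrier →ₗ[k] (tensorPow V (n + 1)).carrier :=
  (TensorProduct.lid k (tensorPow V (n + 1)).carrier).toLinearMap ∘ₗ ξ.rTensor _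

/-- Insertion of a vector as the last factor. -/
def appendTail (q : V.carrier) :
    (tensorPow V (n + 1)).carrier →ₗ[k] (tensorPow V (n + 2)).carrier :=
  lin (tensorPowAssoc V n).hom ∘ₗ
    (TensorProduct.mk k (tensorPow V (n + 1)).carrier V.carrier).flip q

/-- Insertion of a vector as the first factor. -/
def consHead :
    V.carrier →ₗ[k] (tensorPow V (n + 1)).carrier →ₗ[k] (tensorPow V (n + 2)).carrier :=
  TensorProduct.mk k V.carrier (tensorPow V (n + 1)).carrier

/-- The contraction of the last factor with a functional. -/
def contractTail (ξ : Module.Dual k V.carrier) :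
    (tensorPow V (n + 2)).carrier →ₗ[k] (tensorPow V (n + 1)).carrier :=
  ((TensorProduct.rid k (tensorPow V (n + 1)).carrier).toLinearMap ∘ₗ
    ξ.lTensor (tensorPow V (n + 1)).carrier) ∘ₗ lin (tensorPowAssoc V n).inv

/-- Tensor powers are nested to the right, so an operation on the last factor passes under the first
one. This and `contractTail_succ` drive the inductions on the number of factors. -/
theorem appendTail_succ (q : V.carrier) :
    appendTail V (n + 1) q = (appendTail V n q).lTensor V.carrier :=
  TensorProduct.ext' fun _ _ => rfl

theorem contractTail_succ (ξ : Module.Dual k V.carrier) :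
    contractTail V (n + 1) ξ = (contractTail V n ξ).lTensor V.carrier := by
  refine TensorProduct.ext' fun v t => ?_
  change ((TensorProduct.rid k _).toLinearMap ∘ₗ ξ.lTensor _)
    ((TensorProduct.assoc k _ _ _).symm (v ⊗ₜ[k] lin (tensorPowAssoc V n).inv t)) =
    v ⊗ₜ[k] ((TensorProduct.rid k _).toLinearMap ∘ₗ ξ.lTensor _) (lin (tensorPowAssoc V n).inv t)
  generalize lin (tensorPowAssoc V n).inv t = s
  change (tensorPow V (n + 1)).carrier ⊗[k] V.carrier at s
  induction s using TensorProduct.induction_on with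
  | zero => simp
  | add x y hx hy => simp only [TensorProduct.tmul_add, map_add, hx, hy]
  | tmul x y => simp

/-- The action of `a ⊗ b` on `V ⊗ V^{⊗(n+1)}`. -/
def headTailAction (a b : H) :
    (tensorPow V (n + 2)).carrier →ₗ[k] (tensorPow V (n + 2)).carrier :=
  TensorProduct.map (V.ρ a) ((tensorPow V (n + 1)).ρ b)

theorem tensorPow_ρ_succ (h : H) {ι : Type*} (r : Coalgebra.Repr k h ι) :
    (tensorPow V (n + 2)).ρ h = ∑ i ∈ r.index, headTailAction V n (r.left i) (r.right i) :=
  tensorRep_apply _ _ h r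

theorem trace_comp_comp_sum {M N : Type*} [AddCommGroup M] [Module k M] [AddCommGroup N]
    [Module k N] {ι : Type*} (f : N →ₗ[k] M) (g : M →ₗ[k] N) (s : Finset ι)
    (F : ι → M →ₗ[k] M) :
    LinearMap.trace k M (f ∘ₗ g ∘ₗ ∑ i ∈ s, F i) =
      ∑ i ∈ s, LinearMap.trace k M (f ∘ₗ g ∘ₗ F i) :=
  map_sum (LinearMap.trace k M ∘ₗ LinearMap.compRight k (f ∘ₗ g)) F s

/-- The map `v₀ ⊗ ⋯ ⊗ vₙ ↦ ξ(h₁v₀) h₂v₁ ⊗ ⋯ ⊗ hₙ₊₁vₙ ⊗ q` has trace `ξ(h₁h₂⋯hₙ₊₁q)`. -/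
theorem trace_contractHead_appendTail (h : H) (ξ : Module.Dual k V.carrier) (q : V.carrier) :
    LinearMap.trace k _ (contractHead V n ξ ∘ₗ appendTail V n q ∘ₗ (tensorPow V (n + 1)).ρ h) =
      ξ (V.ρ (((WithConv.toConv LinearMap.id : WithConv (H →ₗ[k] H)) ^ (n + 1)).ofConv h) q) := by
  induction n generalizing h ξ with
  | zero =>
    have : contractHead V 0 ξ ∘ₗ appendTail V 0 q ∘ₗ (tensorPow V 1).ρ h =
      (ξ ∘ₗ V.ρ h).smulRight q := rfl
    rw [this]
    refine (LinearMap.trace_smulRight _ _).trans ?_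
    simp only [zero_add, pow_one]
    rfl
  | succ n ih =>
    rw [tensorPow_ρ_succ V n h (ℛ k h), pow_succ']
    rw [trace_comp_comp_sum]
    have : ∀ a b : H, LinearMap.trace k _ (contractHead V (n + 1) ξ ∘ₗ appendTail V (n + 1) q ∘ₗ
        headTailAction V n a b) =
        ξ (V.ρ a (V.ρ (((WithConv.toConv LinearMap.id : WithConv (H →ₗ[k] H)) ^
          (n + 1)).ofConv b) q)) := by
      intro a b
      -- Contracting the head first factors the operator through the smaller tensor power; cyclicity
      -- then turns it into the operator of the induction hypothesis, with $\xi$ replaced by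
      -- $\xi\circ a$.
      have h1 : contractHead V (n + 1) ξ ∘ₗ appendTail V (n + 1) q ∘ₗ
          headTailAction V n a b =
          (appendTail V n q ∘ₗ (tensorPow V (n + 1)).ρ b) ∘ₗ contractHead V n (ξ ∘ₗ V.ρ a) := by
        rw [appendTail_succ]
        refine TensorProduct.ext' fun v w => ?_
        exact (map_smul (appendTail V n q ∘ₗ (tensorPow V (n + 1)).ρ b) (ξ (V.ρ a v)) w).symm
      rw [h1]
      exact (LinearMap.trace_comp_comm' _ _).trans (ih b (ξ ∘ₗ V.ρ a))
    refine (Finset.sum_congr rfl fun i _ => this _ _).trans ?_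
    change _ = ξ (V.ρ (((WithConv.toConv LinearMap.id : WithConv (H →ₗ[k] H)) * _) h) q)
    rw [(ℛ k h).convMul_apply]
    simp

/-- The map `v₀ ⊗ ⋯ ⊗ vₙ ↦ ξ(hₙ₊₁vₙ) q ⊗ h₁v₀ ⊗ ⋯ ⊗ hₙvₙ₋₁` has trace `ξ(hₙ₊₁⋯h₂h₁q)`. -/
theorem trace_contractTail_consHead (h : H) (ξ : Module.Dual k V.carrier) (q : V.carrier) :
    LinearMap.trace k _ (contractTail V n ξ ∘ₗ consHead V n q ∘ₗ (tensorPow V (n + 1)).ρ h) =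
      ξ (V.ρ (opConvPow (k := k) n h) q) := by
  induction n generalizing h q with
  | zero =>
    have : contractTail V 0 ξ ∘ₗ consHead V 0 q ∘ₗ (tensorPow V 1).ρ h =
      (ξ ∘ₗ V.ρ h).smulRight q := rfl
    rw [this]
    exact LinearMap.trace_smulRight _ _
  | succ n ih =>
    rw [tensorPow_ρ_succ V n h (ℛ k h), opConvPow_succ_apply n (ℛ k h)]
    rw [trace_comp_comp_sum]
    have : ∀ a b : H, LinearMap.trace k _ (contractTail V (n + 1) ξ ∘ₗ consHead V (n + 1) q ∘ₗ
        headTailAction V n a b) =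
        ξ (V.ρ (opConvPow (k := k) n b) (V.ρ a q)) := by
      intro a b
      -- Contracting the tail before inserting $q$ factors the operator through the smaller tensor
      -- power. After cyclic exchange $a\otimes b$ acts on $q\otimes w$, so $q$ is replaced by $aq$.
      have h1 : contractTail V (n + 1) ξ ∘ₗ consHead V (n + 1) q ∘ₗ
          headTailAction V n a b =
          consHead V n q ∘ₗ (contractTail V n ξ ∘ₗ
            headTailAction V n a b) := by
        rw [contractTail_succ]
        rfl
      rw [h1]
      exact (LinearMap.trace_comp_comm' _ _).trans (ih b (V.ρ a q))
    refine (Finset.sum_congr rfl fun i _ => this _ _).trans ?_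
    simp

end HMod
end TensorPowers

/-! ### The coproduct of the antipode. -/

section Integrals

open TensorProduct Coalgebra HopfAlgebra

variable {k H : Type*} [Field k] [Ring H] [HopfAlgebra k H]

/-- Coassociativity and the antipode axiom: $S(g_1)g_2\otimes g_3=1\otimes g$. -/
theorem sum_antipode_tmul_one_mul_comul {g : H} {ι : Type*} (r : Coalgebra.Repr k g ι) :
    ∑ i ∈ r.index, (antipode k (r.left i) ⊗ₜ[k] (1 : H)) * comul (r.right i) =
      (1 : H) ⊗ₜ[k] g := by
  have key := Coalgebra.sum_tmul_tmul_eq r (fun i => ℛ k (r.left i)) (fun i => ℛ k (r.right i))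
  have key2 := congrArg ((LinearMap.mul' k H ∘ₗ (antipode k).rTensor H).rTensor H ∘ₗ
    (TensorProduct.assoc k H H H).symm.toLinearMap) key
  have key3 : ∀ i, ∑ j ∈ (ℛ k (r.left i)).index, antipode k ((ℛ k (r.left i)).left j) *
      (ℛ k (r.left i)).right j = counit (R := k) (r.left i) • 1 := fun i =>
    sum_antipode_mul_eq_smul (R := k) (ℛ k (r.left i))
  have key4 : ∀ i, comul (R := k) (r.right i) = ∑ j ∈ (ℛ k (r.right i)).index,
    (ℛ k (r.right i)).left j ⊗ₜ[k] (ℛ k (r.right i)).right j := fun i => (ℛ k (r.right i)).eq.symm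
  simp only [key4, Finset.mul_sum, Algebra.TensorProduct.tmul_mul_tmul, one_mul]
  simp only [map_sum, LinearMap.comp_apply, LinearEquiv.coe_coe, TensorProduct.assoc_symm_tmul,
    LinearMap.rTensor_tmul, LinearMap.mul'_apply, ← TensorProduct.sum_tmul, key3] at key2
  rw [← key2]
  simp only [TensorProduct.smul_tmul, ← TensorProduct.tmul_sum, Coalgebra.sum_counit_smul r]

theorem map_antipode_comm_comul {h : H} {ι : Type*} (r : Coalgebra.Repr k h ι) :
    TensorProduct.map (antipode k) (antipode k) (TensorProduct.comm k H H (comul h)) =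
      ∑ i ∈ r.index, antipode k (r.right i) ⊗ₜ[k] antipode k (r.left i) := by
  conv_lhs => rw [← r.eq]
  simp

/-- The antipode is an antihomomorphism of coalgebras. -/
theorem comul_antipode {h : H} {ι : Type*} (r : Coalgebra.Repr k h ι) :
    comul (R := k) (antipode k h) =
      ∑ i ∈ r.index, antipode k (r.right i) ⊗ₜ[k] antipode k (r.left i) := by
  let G : H →ₗ[k] H ⊗[k] H := TensorProduct.map (antipode k) (antipode k) ∘ₗ
    (TensorProduct.comm k H H).toLinearMap ∘ₗ comul
  -- Both sides are convolution inverses of $\Delta$ in $\mathrm{Hom}(H,H\otimes H)$: $G$ on the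
  -- left, $\Delta\circ S$ on the right.
  have hleft : WithConv.toConv G * WithConv.toConv (comul (R := k) (A := H)) = 1 := by
    ext h
    let r := ℛ k h
    rw [r.convMul_apply]
    change ∑ i ∈ r.index, G (r.left i) * comul (r.right i) = _
    let T : H ⊗[k] (H ⊗[k] H) →ₗ[k] H ⊗[k] H :=
      TensorProduct.lift ((LinearMap.mul k (H ⊗[k] H)) ∘ₗ
        (TensorProduct.mk k H H 1) ∘ₗ antipode k) ∘ₗ
      LinearMap.lTensor H (TensorProduct.lift ((LinearMap.mul k (H ⊗[k] H)).compl₁₂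
        ((TensorProduct.mk k H H).flip 1 ∘ₗ antipode k) comul))
    have hT : ∀ a b c : H, T (a ⊗ₜ (b ⊗ₜ c)) =
        (antipode k b ⊗ₜ[k] antipode k a) * comul c := by
      intro a b c
      simp [T, ← mul_assoc]
    have key := congrArg T
      (Coalgebra.sum_tmul_tmul_eq r (fun i => ℛ k (r.left i)) (fun i => ℛ k (r.right i)))
    simp only [map_sum, hT, ← Finset.sum_mul, ← map_antipode_comm_comul] at key
    refine key.trans ?_
    have h2 : ∀ i, ∑ j ∈ (ℛ k (r.right i)).index,
        (antipode k ((ℛ k (r.right i)).left j) ⊗ₜ[k] antipode k (r.left i)) *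
          comul ((ℛ k (r.right i)).right j) =
        1 ⊗ₜ (antipode k (r.left i) * r.right i) := by
      intro i
      have := congrArg ((1 : H) ⊗ₜ[k] antipode k (r.left i) * ·)
        (sum_antipode_tmul_one_mul_comul (ℛ k (r.right i)))
      simpa [Finset.mul_sum, ← mul_assoc] using this
    simp only [h2, ← TensorProduct.tmul_sum, sum_antipode_mul_eq_smul r]
    simp [Algebra.TensorProduct.one_def, Algebra.algebraMap_eq_smul_one]
  have := congrArg (fun f => f.ofConv h) (left_inv_eq_right_inv hleft LinearMap.comul_right_inv)
  exact this.symm.trans (map_antipode_comm_comul r)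

end Integrals

/-! ### Integrals, dual bases and the trace formula. -/

section Integrals

open TensorProduct Coalgebra HopfAlgebra

variable {k H : Type*} [Field k] [Ring H] [HopfAlgebra k H]

/-- The map `p ↦ p(h₁)h₂` on the dual of a coalgebra. -/
def sliceComul (h : H) : Module.Dual k H →ₗ[k] H where
  toFun p := TensorProduct.lid k H (p.rTensor H (comul h))
  map_add' p q := by simp [LinearMap.rTensor_add]
  map_smul' c p := by simp [LinearMap.rTensor_smul]

theorem sliceComul_apply (h : H) (p : Module.Dual k H) :
    sliceComul h p = TensorProduct.lid k H (p.rTensor H (comul h)) := rfl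

theorem sliceComul_eq_sum {h : H} {ι : Type*} (r : Coalgebra.Repr k h ι) (p : Module.Dual k H) :
    sliceComul h p = ∑ i ∈ r.index, p (r.left i) • r.right i := by
  rw [sliceComul_apply, ← r.eq]
  simp

theorem counit_sliceComul (h : H) (p : Module.Dual k H) :
    counit (R := k) (sliceComul h p) = p h := by
  rw [sliceComul_eq_sum (ℛ k h)]
  conv_rhs => rw [← sum_counit_right_smul (ℛ k h)]
  simp [mul_comm]

/-- Contract the first factor of $\Lambda_1\otimes g\Lambda_2=S(g)\Lambda_1\otimes\Lambda_2$ with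
$p$. Hence the slices of $\Delta(\Lambda)$ form a left ideal. -/
theorem mul_sliceComul {Λ : H} (hΛ : ∀ g : H, g * Λ = counit (R := k) g • Λ) (g : H)
    (p : Module.Dual k H) :
    g * sliceComul Λ p = sliceComul Λ (p ∘ₗ LinearMap.mulLeft k (antipode k g)) := by
  have h1 := congrArg (fun t => TensorProduct.lid k H (p.rTensor H t)) (one_tmul_mul_comul hΛ g)
  rw [sliceComul_eq_sum (ℛ k Λ), sliceComul_eq_sum (ℛ k Λ)]
  rw [← (ℛ k Λ).eq] at h1
  simpa [Finset.mul_sum] using h1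

/-- Coassociativity: slicing is a right action of the convolution algebra $H^*$ on $H$. -/
theorem sliceComul_convolution (h : H) (p q : Module.Dual k H) :
    sliceComul (sliceComul h p) q =
      sliceComul h (LinearMap.mul' k k ∘ₗ TensorProduct.map p q ∘ₗ comul) := by
  let r := ℛ k h
  have key := Coalgebra.sum_tmul_tmul_eq r (fun i => ℛ k (r.left i)) (fun i => ℛ k (r.right i))
  have key2 := congrArg ((TensorProduct.lid k H).toLinearMap ∘ₗ TensorProduct.map p
    ((TensorProduct.lid k H).toLinearMap ∘ₗ q.rTensor H)) key
  have h1 : ∀ i, (LinearMap.mul' k k ∘ₗ TensorProduct.map p q ∘ₗ comul) (r.left i) =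
      ∑ j ∈ (ℛ k (r.left i)).index,
        p ((ℛ k (r.left i)).left j) * q ((ℛ k (r.left i)).right j) := fun i => by
    simp only [LinearMap.comp_apply]
    rw [← (ℛ k (r.left i)).eq]
    simp
  have h2 : sliceComul (sliceComul h p) q = ∑ i ∈ r.index, p (r.left i) •
      sliceComul (r.right i) q := by
    rw [sliceComul_eq_sum r p, sliceComul_apply]
    simp [sliceComul_apply]
  rw [h2, sliceComul_eq_sum r]
  simp only [h1, fun i => sliceComul_eq_sum (ℛ k (r.right i)) q]
  simp only [map_sum, LinearMap.comp_apply, TensorProduct.map_tmul, LinearMap.rTensor_tmul,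
    LinearEquiv.coe_coe, TensorProduct.lid_tmul] at key2
  simpa [Finset.smul_sum, Finset.sum_smul, mul_smul] using key2.symm

/-- A pair of a left integral `Λ` of `H` and a right integral `l` of `H*` with `l(Λ) = 1`. -/
structure IsIntegralPair (Λ : H) (l : Module.Dual k H) : Prop where
  mul_eq : ∀ g : H, g * Λ = counit (R := k) g • Λ
  sliceComul_eq : ∀ h : H, sliceComul h l = l h • 1
  apply_eq : l Λ = 1

section FiniteDimensional

variable [FiniteDimensional k H]

/-- The slices form a left ideal, so it suffices that this ideal contains a nonzero multiple of $1$.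
It contains $f(\Lambda_1)S(\Lambda_2)\Lambda_3=f(\Lambda)1$, where $f(\Lambda)\ne0$. -/
theorem sliceComul_surjective {Λ : H} (hΛ0 : Λ ≠ 0)
    (hΛ : ∀ g : H, g * Λ = counit (R := k) g • Λ) :
    Function.Surjective (sliceComul (k := k) Λ) := by
  obtain ⟨f, hf⟩ : ∃ f : Module.Dual k H, f Λ ≠ 0 := by
    by_contra! hc
    exact hΛ0 ((Module.forall_dual_apply_eq_zero_iff k Λ).mp hc)
  let b := Module.Basis.ofVectorSpace k H
  let r := ℛ k Λ
  let L : H →ₗ[k] H := (TensorProduct.lid k H).toLinearMap ∘ₗ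
    TensorProduct.map f (antipode k) ∘ₗ comul
  -- Expanding $\Lambda_1$ in a basis exhibits $L(\Lambda_1)\Lambda_2$ as a left combination of
  -- slices.
  have hL : ∑ i ∈ r.index, L (r.left i) * r.right i =
      sliceComul Λ (∑ c, b.coord c ∘ₗ LinearMap.mulLeft k (antipode k (L (b c)))) := by
    simp only [map_sum, ← mul_sliceComul hΛ]
    simp only [fun c => sliceComul_eq_sum r (b.coord c), Finset.mul_sum]
    rw [Finset.sum_comm]
    refine Finset.sum_congr rfl fun i _ => ?_
    conv_lhs => rw [← b.sum_repr (r.left i)]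
    simp only [map_sum, map_smul, Finset.sum_mul, mul_smul_comm, smul_mul_assoc,
      Module.Basis.coord_apply]
  have key := Coalgebra.sum_tmul_tmul_eq r (fun i => ℛ k (r.left i)) (fun i => ℛ k (r.right i))
  have key2 := congrArg ((TensorProduct.lid k H).toLinearMap ∘ₗ
    TensorProduct.map f (LinearMap.mul' k H ∘ₗ (antipode k).rTensor H)) key
  have key3 : ∀ i, ∑ j ∈ (ℛ k (r.right i)).index, antipode k ((ℛ k (r.right i)).left j) *
      (ℛ k (r.right i)).right j = counit (R := k) (r.right i) • 1 := fun i =>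
    sum_antipode_mul_eq_smul (R := k) (ℛ k (r.right i))
  have key4 : ∀ i, L (r.left i) = ∑ j ∈ (ℛ k (r.left i)).index,
      f ((ℛ k (r.left i)).left j) • antipode k ((ℛ k (r.left i)).right j) := by
    intro i
    simp only [L, LinearMap.comp_apply]
    rw [← (ℛ k (r.left i)).eq]
    simp
  have key5 : ∑ i ∈ r.index, L (r.left i) * r.right i = f Λ • 1 := by
    simp only [map_sum, LinearMap.comp_apply, TensorProduct.map_tmul, LinearMap.rTensor_tmul,
      LinearMap.mul'_apply, LinearEquiv.coe_coe, TensorProduct.lid_tmul, ← Finset.smul_sum,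
      key3] at key2
    simp only [key4, Finset.sum_mul, smul_mul_assoc]
    rw [key2]
    conv_rhs => rw [← sum_counit_right_smul r]
    simp only [map_sum, map_smul, Finset.sum_smul]
    exact Finset.sum_congr rfl fun i _ => by rw [smul_smul, smul_eq_mul, mul_comm]
  rw [key5] at hL
  intro h
  refine ⟨(f Λ)⁻¹ • ((∑ c, b.coord c ∘ₗ LinearMap.mulLeft k (antipode k (L (b c)))) ∘ₗ
    LinearMap.mulLeft k (antipode k h)), ?_⟩
  rw [map_smul, ← mul_sliceComul hΛ, ← hL, mul_smul_comm, smul_smul, inv_mul_cancel₀ hf, one_smul,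
    mul_one]

/-- Slicing $\Delta(\Lambda)$ is bijective by dimension, and $l$ is the functional with slice $1$.
For every $q$, both $l\star q$ and $q(1)l$ have slice $q(1)1$, so they agree and $l$ is a right
integral; applying $\varepsilon$ to its slice gives $l(\Lambda)=1$. -/
theorem exists_isIntegralPair : ∃ (Λ : H) (l : Module.Dual k H), IsIntegralPair Λ l := by
  obtain ⟨Λ, hΛ0, hΛ⟩ := exists_leftIntegral (k := k) (H := H)
  have hsurj := sliceComul_surjective hΛ0 hΛ
  have hinj : Function.Injective (sliceComul (k := k) Λ) :=
    (LinearMap.injective_iff_surjective_of_finrank_eq_finrank (Subspace.dual_finrank_eq)).mpr hsurj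
  obtain ⟨l, hl⟩ := hsurj 1
  refine ⟨Λ, l, hΛ, fun h => ?_, ?_⟩
  · rw [← sub_eq_zero]
    refine (Module.forall_dual_apply_eq_zero_iff k _).mp fun q => ?_
    have h1 : LinearMap.mul' k k ∘ₗ TensorProduct.map l q ∘ₗ comul = q 1 • l := by
      apply hinj
      rw [← sliceComul_convolution, map_smul, hl, sliceComul_apply, Bialgebra.comul_one]
      simp [Algebra.TensorProduct.one_def]
    have h2 := LinearMap.congr_fun h1 h
    rw [LinearMap.comp_apply, LinearMap.comp_apply, ← (ℛ k h).eq] at h2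
    rw [map_sub, sliceComul_eq_sum (ℛ k h)]
    simp at h2
    simp [h2, mul_comm]
  · rw [← counit_sliceComul, hl, Bialgebra.counit_one]

end FiniteDimensional

namespace IsIntegralPair

variable {Λ : H} {l : Module.Dual k H}

theorem antipode_mul [FiniteDimensional k H] (hl : IsIntegralPair Λ l) (g : H) :
    antipode k Λ * g = counit (R := k) g • antipode k Λ := by
  obtain ⟨g, rfl⟩ := (antipode_bijective (k := k)).2 g
  rw [← antipode_mul_antidistrib, hl.mul_eq, map_smul, counit_antipode]

/-- The right integral property of $l$ at $S(x)h$, expanded with $\Delta(S(x))=S(x_2)\otimes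
S(x_1)$. -/
theorem apply_antipode_mul_smul_one (hl : IsIntegralPair Λ l) {x h : H} {ι κ : Type*}
    (r : Coalgebra.Repr k x ι) (s : Coalgebra.Repr k h κ) :
    l (antipode k x * h) • (1 : H) = ∑ j ∈ s.index, ∑ i ∈ r.index,
      l (antipode k (r.right i) * s.left j) • (antipode k (r.left i) * s.right j) := by
  rw [← hl.sliceComul_eq, sliceComul_apply, Bialgebra.comul_mul, comul_antipode r, ← s.eq]
  simp [Finset.mul_sum, Finset.sum_mul]

/-- By the preceding identity the sum is
$l(S(\Lambda_3)h_1)\,\Lambda_1S(\Lambda_2)h_2=l(S(\Lambda)h_1)h_2$, and $S(\Lambda)$ is a right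
integral. -/
theorem sum_apply_antipode_mul_smul_aux [FiniteDimensional k H] (hl : IsIntegralPair Λ l)
    {ι : Type*} (r : Coalgebra.Repr k Λ ι) (h : H) :
    ∑ i ∈ r.index, l (antipode k (r.right i) * h) • r.left i = l (antipode k Λ) • h := by
  let s := ℛ k h
  have h1 : ∀ a b : H, ∑ i ∈ r.index, ∑ m ∈ (ℛ k (r.right i)).index,
      l (antipode k ((ℛ k (r.right i)).right m) * a) •
        (r.left i * (antipode k ((ℛ k (r.right i)).left m) * b)) =
      l (antipode k Λ * a) • b := by
    intro a b
    have key := Coalgebra.sum_tmul_tmul_eq r (fun i => ℛ k (r.left i)) (fun i => ℛ k (r.right i))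
    have key2 := congrArg ((TensorProduct.rid k H).toLinearMap ∘ₗ TensorProduct.map
      (LinearMap.mulRight k b ∘ₗ LinearMap.mul' k H ∘ₗ (antipode k).lTensor H)
      (l ∘ₗ LinearMap.mulRight k a ∘ₗ antipode k) ∘ₗ
        (TensorProduct.assoc k H H H).symm.toLinearMap) key
    have key3 : ∀ i, ∑ j ∈ (ℛ k (r.left i)).index, (ℛ k (r.left i)).left j *
        (antipode k ((ℛ k (r.left i)).right j) * b) = counit (R := k) (r.left i) • b := fun i => by
      simp only [← mul_assoc, ← Finset.sum_mul, sum_mul_antipode_eq_smul, smul_mul_assoc, one_mul]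
    simp [mul_assoc, ← Finset.smul_sum, key3, smul_smul] at key2
    rw [← key2, ← Finset.sum_smul]
    congr 1
    conv_rhs => rw [← Coalgebra.sum_counit_smul r]
    simp [Finset.sum_mul, mul_comm]
  calc _ = ∑ i ∈ r.index, r.left i * (l (antipode k (r.right i) * h) • (1 : H)) := by simp
    _ = ∑ i ∈ r.index, r.left i * ∑ j ∈ s.index, ∑ m ∈ (ℛ k (r.right i)).index,
        l (antipode k ((ℛ k (r.right i)).right m) * s.left j) •
          (antipode k ((ℛ k (r.right i)).left m) * s.right j) := by
      simp only [fun i => hl.apply_antipode_mul_smul_one (ℛ k (r.right i)) s]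
    _ = ∑ j ∈ s.index, l (antipode k Λ * s.left j) • s.right j := by
      simp only [Finset.mul_sum, mul_smul_comm]
      rw [Finset.sum_comm]
      exact Finset.sum_congr rfl fun j _ => h1 _ _
    _ = l (antipode k Λ) • h := by
      conv_rhs => rw [← Coalgebra.sum_counit_smul s]
      simp [hl.antipode_mul, Finset.smul_sum, smul_smul, mul_comm]

/-- At $h=\Lambda$ the left side of the preceding identity is
$\Lambda_1\varepsilon(\Lambda_2)l(\Lambda)=\Lambda$, which forces its constant to be $1$. -/
theorem apply_antipode [FiniteDimensional k H] (hl : IsIntegralPair Λ l) :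
    l (antipode k Λ) = 1 := by
  have h0 : Λ ≠ 0 := by
    rintro rfl
    simpa using hl.apply_eq
  have h1 := hl.sum_apply_antipode_mul_smul_aux (ℛ k Λ) Λ
  simp only [hl.mul_eq, counit_antipode, map_smul, hl.apply_eq, smul_eq_mul, mul_one] at h1
  rw [sum_counit_right_smul] at h1
  exact smul_left_injective k h0 (h1.symm.trans (one_smul k Λ).symm)

/-- The elements `Λ₁` and the functionals `l(S(Λ₂) ·)` are dual bases. -/
theorem sum_apply_antipode_mul_smul [FiniteDimensional k H] (hl : IsIntegralPair Λ l)
    {ι : Type*} (r : Coalgebra.Repr k Λ ι) (h : H) :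
    ∑ i ∈ r.index, l (antipode k (r.right i) * h) • r.left i = h := by
  rw [hl.sum_apply_antipode_mul_smul_aux, hl.apply_antipode, one_smul]

theorem trace_eq_sum [FiniteDimensional k H] (hl : IsIntegralPair Λ l)
    {ι : Type*} (r : Coalgebra.Repr k Λ ι) (f : H →ₗ[k] H) :
    LinearMap.trace k H f = ∑ i ∈ r.index, l (antipode k (r.right i) * f (r.left i)) := by
  have h1 : f = ∑ i ∈ r.index,
      (l ∘ₗ LinearMap.mulLeft k (antipode k (r.right i))).smulRight (f (r.left i)) := by
    ext h
    conv_lhs => rw [← hl.sum_apply_antipode_mul_smul r h]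
    simp
  conv_lhs => rw [h1]
  simp

end IsIntegralPair

end Integrals

/-! ### Indicators of index at least two for the dual of the regular object. -/

section PositiveIndicator

open TensorProduct Coalgebra HopfAlgebra FSIndicator.HMod

variable {k H : Type u} [Field k] [Ring H] [HopfAlgebra k H]

namespace HMod

theorem contractTail_tensorPowAssoc (V : HMod k H) (n : ℕ) (ξ : Module.Dual k V.carrier)
    (T : V.carrier →ₗ[k] V.carrier) (t : V.carrier ⊗[k] (tensorPow V (n + 1)).carrier) :
    contractTail V n ξ (lin (tensorPowAssoc V n).hom (T.lTensor (tensorPow V (n + 1)).carrier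
      (TensorProduct.comm k V.carrier (tensorPow V (n + 1)).carrier t))) =
      contractHead V n (ξ ∘ₗ T) t := by
  have h1 : ∀ s, lin (tensorPowAssoc V n).inv (lin (tensorPowAssoc V n).hom s) = s :=
    fun s => congrArg (fun f => lin f s) (tensorPowAssoc V n).hom_inv_id
  change TensorProduct.rid k _ (ξ.lTensor (tensorPow V (n + 1)).carrier
    (lin (tensorPowAssoc V n).inv (lin (tensorPowAssoc V n).hom _))) = _
  rw [h1]
  change _ = TensorProduct.lid k _ ((ξ ∘ₗ T).rTensor _ t)
  induction t using TensorProduct.induction_on with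
  | zero => simp only [map_zero]
  | add x y hx hy => simp only [map_add, hx, hy]
  | tmul x y => simp

/-- The value at `1` of a morphism from the unit object. -/
def unitValue (V : HMod k H) : (𝟙_ (HMod k H) ⟶ V) →ₗ[k] V.carrier where
  toFun f := lin f (1 : k)
  map_add' _ _ := rfl
  map_smul' _ _ := rfl

theorem contractTail_unitValue_indicatorMap (V : PivotalObject (HMod k H)) (n : ℕ)
    (ξ : Module.Dual k V.obj.carrier) (f : 𝟙_ (HMod k H) ⟶ tensorPow V.obj (n + 2)) :
    contractTail V.obj n ξ (unitValue (tensorPow V.obj (n + 2)) (indicatorMap k V (n + 1) f)) =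
      contractHead V.obj n (ξ ∘ₗ pivotMap V) (unitValue (tensorPow V.obj (n + 2)) f) :=
  (congrArg (contractTail V.obj n ξ) (lin_indicatorMap_succ_one V n f)).trans
    (contractTail_tensorPowAssoc V.obj n ξ (pivotMap V) _)

/-- The rotation moves the first factor to the last place through $\psi$, so reading off the
parameter there with $\xi$ is contracting the original first factor with $\xi\circ\psi$. -/
theorem trace_indicatorMap_succ (V : PivotalObject (HMod k H)) (n : ℕ)
    (e : (tensorPow V.obj (n + 1)).carrier ≃ₗ[k] (𝟙_ (HMod k H) ⟶ tensorPow V.obj (n + 2)))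
    (ξ ξ' : Module.Dual k V.obj.carrier) (hξ : ∀ v, ξ (pivotMap V v) = ξ' v)
    (he : ∀ f, e.symm f = contractTail V.obj n ξ (unitValue _ f)) :
    LinearMap.trace k (𝟙_ (HMod k H) ⟶ tensorPow V.obj (n + 2))
      (indicatorMap k V (n + 1)).toLinearMap =
      LinearMap.trace k _ (contractHead V.obj n ξ' ∘ₗ
        unitValue (tensorPow V.obj (n + 2)) ∘ₗ e.toLinearMap) := by
  obtain rfl : ξ ∘ₗ pivotMap V = ξ' := LinearMap.ext hξ
  rw [← LinearMap.trace_conj' _ e.symm]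
  congr 1
  refine LinearMap.ext fun w => ?_
  refine (he (indicatorMap k V (n + 1) (e w))).trans ?_
  exact contractTail_unitValue_indicatorMap V n ξ (e w)

variable [FiniteDimensional k H]

/-- Homomorphisms from the regular module to `W` are the elements of `W`. -/
def regularHomEquiv (W : HMod k H) : W.carrier ≃ₗ[k] (𝟙_ (HMod k H) ⊗ regular k H ⟶ W) where
  toFun w := (λ_ _).hom ≫ ofLin (V := regular k H) (W.ρ.toLinearMap.flip w) fun h =>
    LinearMap.ext fun x => LinearMap.congr_fun (map_mul W.ρ h x) w
  map_add' w w' := hom_ext (TensorProduct.ext' fun c h => map_add (W.ρ (c • h)) w w')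
  map_smul' a w := hom_ext (TensorProduct.ext' fun c h => map_smul (W.ρ (c • h)) a w)
  invFun f := lin f ((1 : k) ⊗ₜ[k] (1 : H))
  left_inv w := by
    change W.ρ ((1 : k) • (1 : H)) w = w
    simp
  right_inv f := by
    refine hom_ext (TensorProduct.ext' fun c h => ?_)
    change H at h
    change k at c
    have h1 := LinearMap.congr_fun (lin_comm ((λ_ (regular k H)).inv ≫ f) (c • h)) (1 : H)
    change lin f ((1 : k) ⊗ₜ[k] ((c • h) * 1)) = W.ρ (c • h) (lin f ((1 : k) ⊗ₜ[k] (1 : H))) at h1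
    have h2 : (1 : k) ⊗ₜ[k] ((c • h) * 1) = c ⊗ₜ[k] h := by
      rw [mul_one, TensorProduct.tmul_smul, TensorProduct.smul_tmul', smul_eq_mul, mul_one]
    exact h1.symm.trans (congrArg (lin f) h2)

/-- The invariants of `V^{⊗(n+1)} ⊗ V` for the dual `V` of the regular module are the elements
of `V^{⊗(n+1)}`. -/
def invariantsDualRegularEquiv (n : ℕ) :
    (tensorPow (dual (regular k H)) (n + 1)).carrier ≃ₗ[k]
      (𝟙_ (HMod k H) ⟶ tensorPow (dual (regular k H)) (n + 2)) :=
  regularHomEquiv _ ≪≫ₗ homRightEquiv k (regular k H) (𝟙_ _) _ ≪≫ₗ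
    Linear.homCongr k (Iso.refl _) (tensorPowAssoc (dual (regular k H)) n)

theorem unitValue_invariantsDualRegularEquiv (n : ℕ)
    (w : (tensorPow (dual (regular k H)) (n + 1)).carrier) :
    unitValue _ (invariantsDualRegularEquiv n w) =
      ∑ i, appendTail (dual (regular k H)) n ((Module.Basis.ofVectorSpace k H).coord i)
        ((tensorPow (dual (regular k H)) (n + 1)).ρ (Module.Basis.ofVectorSpace k H i) w) := by
  have h1 := lin_homRightEquiv_one (regular k H) _ (regularHomEquiv _ w)
  have h2 := congrArg (lin (tensorPowAssoc (dual (regular k H)) n).hom) h1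
  refine h2.trans ((map_sum (lin (tensorPowAssoc (dual (regular k H)) n).hom) _ _).trans
    (Finset.sum_congr rfl fun i _ => ?_))
  change lin (tensorPowAssoc (dual (regular k H)) n).hom
    ((tensorPow (dual (regular k H)) (n + 1)).ρ ((1 : k) • Module.Basis.ofVectorSpace k H i) w ⊗ₜ[k]
      (Module.Basis.ofVectorSpace k H).coord i) = _
  rw [one_smul]
  rfl

/-- Evaluation at `1 ∈ H` as a functional on the dual of the regular module. -/
def evalOne : Module.Dual k (dual (regular k H)).carrier := Module.Dual.eval k H 1

theorem invariantsDualRegularEquiv_symm_apply (n : ℕ)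
    (f : 𝟙_ (HMod k H) ⟶ tensorPow (dual (regular k H)) (n + 2)) :
    (invariantsDualRegularEquiv n).symm f =
      contractTail (dual (regular k H)) n evalOne (unitValue _ f) := by
  obtain ⟨w, rfl⟩ := (invariantsDualRegularEquiv n).surjective f
  rw [LinearEquiv.symm_apply_apply, unitValue_invariantsDualRegularEquiv, map_sum]
  have h1 : ∀ (p : Module.Dual k H) (t : (tensorPow (dual (regular k H)) (n + 1)).carrier),
      contractTail (dual (regular k H)) n evalOne (appendTail (dual (regular k H)) n p t) =
        p 1 • t := by
    intro p t
    have h2 : ∀ s, lin (tensorPowAssoc (dual (regular k H)) n).inv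
        (lin (tensorPowAssoc (dual (regular k H)) n).hom s) = s :=
      fun s => congrArg (fun f => lin f s) (tensorPowAssoc (dual (regular k H)) n).hom_inv_id
    change TensorProduct.rid k _ (evalOne.lTensor _ (lin (tensorPowAssoc _ n).inv
      (lin (tensorPowAssoc _ n).hom (t ⊗ₜ[k] p)))) = _
    rw [h2]
    rfl
  simp only [h1]
  have h2 := congrArg (fun a => (tensorPow (dual (regular k H)) (n + 1)).ρ a w)
    ((Module.Basis.ofVectorSpace k H).sum_repr 1)
  simp only [map_sum, map_smul, map_one, LinearMap.sum_apply, LinearMap.smul_apply] at h2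
  exact h2.symm

/-- The pivotal structure of the dual is $(\phi^*)^{-1}$, so its inverse is the transpose of $\phi$,
which carries $S^2$. -/
theorem pivotMap_dual_regularPivotal (p : Module.Dual k H) :
    pivotMap (regularPivotal k H).dual p =
      (p ∘ₗ (antipode k ∘ₗ antipode k : H →ₗ[k] H) : Module.Dual k H) := by
  refine (lin_dualMap_apply (regularPivotal k H).φ.hom (Module.Dual.eval k _ p)).trans ?_
  rfl

theorem evalOne_pivotMap (p : Module.Dual k H) :
    evalOne (pivotMap (regularPivotal k H).dual p) = evalOne (H := H) p := by
  refine (congrArg (evalOne (k := k) (H := H)) (pivotMap_dual_regularPivotal p)).trans ?_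
  have h1 : antipode k (antipode k (1 : H)) = 1 := by rw [antipode_one, antipode_one]
  exact congrArg (fun x : H => @DFunLike.coe (Module.Dual k H) _ _ _ p x) h1

/-- The trace of `E^{(n+2)}` for the dual of the regular pivotal object. -/
theorem trace_indicatorMap_succ_dual_regularPivotal (n : ℕ) :
    LinearMap.trace k _ (indicatorMap k (regularPivotal k H).dual (n + 1)).toLinearMap =
      LinearMap.trace k H (antipode k ∘ₗ
        ((WithConv.toConv LinearMap.id : WithConv (H →ₗ[k] H)) ^ (n + 1)).ofConv) := by
  let b := Module.Basis.ofVectorSpace k H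
  let V := dual (regular k H)
  refine (trace_indicatorMap_succ (regularPivotal k H).dual n (invariantsDualRegularEquiv n)
    (evalOne (H := H)) (evalOne (H := H)) (evalOne_pivotMap (H := H))
    (invariantsDualRegularEquiv_symm_apply n)).trans ?_
  have h1 : contractHead V n evalOne ∘ₗ unitValue (tensorPow V (n + 2)) ∘ₗ
      (invariantsDualRegularEquiv n).toLinearMap =
      ∑ i, contractHead V n evalOne ∘ₗ appendTail V n (b.coord i) ∘ₗ
        (tensorPow V (n + 1)).ρ (b i) := by
    refine LinearMap.ext fun w => ?_
    refine (congrArg (contractHead V n evalOne) (unitValue_invariantsDualRegularEquiv n w)).trans ?_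
    rw [map_sum, LinearMap.sum_apply]
    rfl
  refine (congrArg (LinearMap.trace k (tensorPow V (n + 1)).carrier) h1).trans ?_
  rw [map_sum]
  refine (Finset.sum_congr rfl fun i _ =>
    trace_contractHead_appendTail V n (b i) evalOne (b.coord i)).trans ?_
  classical
  rw [LinearMap.trace_eq_matrix_trace k b]
  simp only [Matrix.trace, Matrix.diag, LinearMap.toMatrix_apply]
  refine Finset.sum_congr rfl fun i _ => ?_
  -- Evaluating $h\cdot b^i$ at $1$ is evaluating $b^i$ at $S(h)1$; the outer antipode of the KMN
  -- trace comes from this dual action.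
  change b.coord i (antipode k _ * 1) = _
  rw [mul_one]
  rfl

end HMod
end PositiveIndicator

/-! ### Convolution powers of the antipode evaluated on integrals. -/

section ConvolutionPowers

open TensorProduct Coalgebra HopfAlgebra

variable {k H : Type*} [Field k] [Ring H] [HopfAlgebra k H]

theorem ofConv_antipode_pow_succ_apply (j : ℕ) {h : H} {ι : Type*} (r : Coalgebra.Repr k h ι) :
    ((WithConv.toConv (antipode k) : WithConv (H →ₗ[k] H)) ^ (j + 1)).ofConv h =
      ∑ i ∈ r.index, ((WithConv.toConv (antipode k) : WithConv (H →ₗ[k] H)) ^ j).ofConv (r.left i) *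
        antipode k (r.right i) := by
  rw [pow_succ]
  exact r.convMul_apply _ _

theorem ofConv_antipode_pow_succ_apply' (j : ℕ) {h : H} {ι : Type*} (r : Coalgebra.Repr k h ι) :
    ((WithConv.toConv (antipode k) : WithConv (H →ₗ[k] H)) ^ (j + 1)).ofConv h =
      ∑ i ∈ r.index, antipode k (r.left i) *
        ((WithConv.toConv (antipode k) : WithConv (H →ₗ[k] H)) ^ j).ofConv (r.right i) := by
  rw [pow_succ']
  exact r.convMul_apply _ _

/-- One application of $S$ reverses the product: $S(h_{j+1}\cdots h_1)=S(h_1)\cdots S(h_{j+1})$. -/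
theorem antipode_antipode_opConvPow (j : ℕ) (h : H) :
    antipode k (antipode k (opConvPow (k := k) j h)) =
      antipode k (((WithConv.toConv (antipode k) : WithConv (H →ₗ[k] H)) ^ (j + 1)).ofConv h) := by
  induction j generalizing h with
  | zero => simp [opConvPow]
  | succ j ih =>
    rw [opConvPow_succ_apply j (ℛ k h), ofConv_antipode_pow_succ_apply' (j + 1) (ℛ k h)]
    simp [antipode_mul_antidistrib, ih]

/-- The trace formula gives $l\bigl(S(\Lambda_3)S^2(\Lambda_2)S(S^{\star j}(\Lambda_1))\bigr)$.
Since $S(x_2)S^2(x_1)=S(S(x_1)x_2)=\varepsilon(x)1$, one convolution factor cancels. -/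
theorem IsIntegralPair.trace_antipode_comp_pow [FiniteDimensional k H] {Λ : H}
    {l : Module.Dual k H} (hl : IsIntegralPair Λ l) (j : ℕ) :
    LinearMap.trace k H (antipode k ∘ₗ
      ((WithConv.toConv (antipode k) : WithConv (H →ₗ[k] H)) ^ (j + 1)).ofConv) =
      l (antipode k (((WithConv.toConv (antipode k) : WithConv (H →ₗ[k] H)) ^ j).ofConv Λ)) := by
  let P : H →ₗ[k] H := ((WithConv.toConv (antipode k) : WithConv (H →ₗ[k] H)) ^ j).ofConv
  let r := ℛ k Λ
  rw [hl.trace_eq_sum r]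
  simp only [LinearMap.comp_apply,
    fun i => ofConv_antipode_pow_succ_apply j (ℛ k (r.left i)), map_sum, antipode_mul_antidistrib,
    Finset.mul_sum, ← mul_assoc]
  have key := Coalgebra.sum_tmul_tmul_eq r (fun i => ℛ k (r.left i)) (fun i => ℛ k (r.right i))
  have key2 := congrArg (l ∘ₗ LinearMap.mul' k H ∘ₗ (TensorProduct.comm k H H).toLinearMap ∘ₗ
    TensorProduct.map (antipode k ∘ₗ P)
      (antipode k ∘ₗ LinearMap.mul' k H ∘ₗ (antipode k).rTensor H)) key
  have key3 : ∀ i, ∑ x ∈ (ℛ k (r.right i)).index,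
      antipode k ((ℛ k (r.right i)).right x) *
        antipode k (antipode k ((ℛ k (r.right i)).left x)) =
      counit (R := k) (r.right i) • 1 := fun i => by
    have := congrArg (antipode k) (sum_antipode_mul_eq_smul (R := k) (ℛ k (r.right i)))
    simpa [antipode_mul_antidistrib] using this
  simp only [map_sum, LinearMap.comp_apply, LinearEquiv.coe_coe, TensorProduct.map_tmul,
    LinearMap.rTensor_tmul, LinearMap.mul'_apply, TensorProduct.comm_tmul,
    antipode_mul_antidistrib] at key2
  refine key2.trans ?_
  simp only [← map_sum, ← Finset.sum_mul, key3, smul_mul_assoc, one_mul]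
  conv_rhs => rw [← sum_counit_right_smul r]
  simp [P]

end ConvolutionPowers

/-! ### Invariants in tensor powers of the regular module. -/

section NegativeIndicator

open TensorProduct Coalgebra HopfAlgebra FSIndicator.HMod

variable {k H : Type u} [Field k] [Ring H] [HopfAlgebra k H]

namespace HMod

theorem tensorPow_ρ_consHead (V : HMod k H) (n : ℕ) (h : H) {ι : Type*}
    (r : Coalgebra.Repr k h ι) (v : V.carrier) (w : (tensorPow V (n + 1)).carrier) :
    (tensorPow V (n + 2)).ρ h (consHead V n v w) = ∑ i ∈ r.index,
      consHead V n (V.ρ (r.left i) v) ((tensorPow V (n + 1)).ρ (r.right i) w) := by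
  rw [tensorPow_ρ_succ V n h r, LinearMap.sum_apply]
  rfl

theorem contractHead_consHead (V : HMod k H) (n : ℕ) (ξ : Module.Dual k V.carrier) (v : V.carrier)
    (w : (tensorPow V (n + 1)).carrier) :
    contractHead V n ξ (consHead V n v w) = ξ v • w := rfl

theorem tensorPow_hom_ext {V : HMod k H} {n : ℕ} {M : Type*} [AddCommGroup M] [Module k M]
    {f g : (tensorPow V (n + 2)).carrier →ₗ[k] M}
    (h : ∀ v w, f (consHead V n v w) = g (consHead V n v w)) : f = g :=
  TensorProduct.ext' h

theorem ρ_unitValue {V : HMod k H} (f : 𝟙_ (HMod k H) ⟶ V) (h : H) :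
    V.ρ h (unitValue V f) = counit (R := k) h • unitValue V f := by
  rw [← map_smul]
  refine (LinearMap.congr_fun (lin_comm f h) (1 : k)).symm.trans ?_
  change lin f (counit (R := k) h * 1) = lin (counit (R := k) h • f) (1 : k)
  rw [mul_one, lin_smul, LinearMap.smul_apply, ← map_smul]
  congr 1
  exact (mul_one (counit (R := k) h)).symm

/-- The morphism from the unit object with a given invariant value. -/
def ofInvariant {V : HMod k H} (v : V.carrier) (hv : ∀ h : H, V.ρ h v = counit (R := k) h • v) :
    𝟙_ (HMod k H) ⟶ V :=
  ofLin (LinearMap.toSpanSingleton k V.carrier v) fun h => LinearMap.ext fun c => by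
    change (counit (R := k) h * (c : k)) • v = V.ρ h ((c : k) • v)
    rw [map_smul, hv, smul_smul, mul_comm]

theorem unitValue_injective (V : HMod k H) : Function.Injective (unitValue V) :=
  fun _ _ h => hom_unit_ext h

theorem unitValue_ofInvariant {V : HMod k H} (v : V.carrier)
    (hv : ∀ h : H, V.ρ h v = counit (R := k) h • v) : unitValue V (ofInvariant v hv) = v :=
  one_smul k v

/-- A parametrization `j : M → V` of the invariants of `V` as an isomorphism with the space of
morphisms from the unit object. -/
def unitHomEquiv {V : HMod k H} {M : Type*} [AddCommGroup M] [Module k M]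
    (j : M →ₗ[k] V.carrier) (π : V.carrier →ₗ[k] M)
    (hj : ∀ m (h : H), V.ρ h (j m) = counit (R := k) h • j m) (hπj : ∀ m, π (j m) = m)
    (hjπ : ∀ f : 𝟙_ (HMod k H) ⟶ V, j (π (unitValue V f)) = unitValue V f) :
    M ≃ₗ[k] (𝟙_ (HMod k H) ⟶ V) where
  toFun m := ofInvariant (j m) (hj m)
  map_add' m m' := unitValue_injective V (by simp only [map_add, unitValue_ofInvariant])
  map_smul' c m := unitValue_injective V (by
    simp only [map_smul, unitValue_ofInvariant, RingHom.id_apply])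
  invFun f := π (unitValue V f)
  left_inv m := by simp only [unitValue_ofInvariant, hπj]
  right_inv f := unitValue_injective V (by simp only [unitValue_ofInvariant, hjπ])

variable {V : HMod k H} {n : ℕ} {Λ : H} {l : Module.Dual k H} (θ : H ≃ₗ[k] V.carrier)

/-- The map `(a ⊗ b, w) ↦ θ(a) ⊗ bw`. -/
def consAction (n : ℕ) :
    (tensorPow V (n + 1)).carrier →ₗ[k] H ⊗[k] H →ₗ[k] (tensorPow V (n + 2)).carrier :=
  LinearMap.flip (TensorProduct.lift (LinearMap.mk₂ k
    (fun a b => consHead V n (θ a) ∘ₗ (tensorPow V (n + 1)).ρ b)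
    (fun a a' b => by simp [LinearMap.add_comp])
    (fun c a b => by simp [LinearMap.smul_comp])
    (fun a b b' => by simp [LinearMap.comp_add])
    (fun c a b => by simp [LinearMap.comp_smul])))

theorem consAction_tmul (w : (tensorPow V (n + 1)).carrier) (a b : H) :
    consAction θ n w (a ⊗ₜ[k] b) = consHead V n (θ a) ((tensorPow V (n + 1)).ρ b w) := by
  simp [consAction]

theorem ρ_consAction (hθ : ∀ a x, θ (a * x) = V.ρ a (θ x))
    (w : (tensorPow V (n + 1)).carrier) (g : H) (t : H ⊗[k] H) :
    (tensorPow V (n + 2)).ρ g (consAction θ n w t) = consAction θ n w (comul g * t) := by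
  induction t using TensorProduct.induction_on with
  | zero => simp
  | add x y hx hy => simp only [map_add, mul_add, hx, hy]
  | tmul a b =>
    rw [consAction_tmul, tensorPow_ρ_consHead V n g (ℛ k g)]
    conv_rhs => rw [← (ℛ k g).eq]
    simp [Finset.sum_mul, consAction_tmul, hθ]

/-- On $\theta(y)\otimes w$ the left side is $l(S(g_3)y)\,g_1S(g_2)w$. For invariant $t$ it says how
$g$ acts on the contraction of $t$ with $l$. -/
theorem ρ_contractHead_ρ_antipode (hθ : ∀ a x, θ (a * x) = V.ρ a (θ x))
    (g : H) {ι : Type*} (r : Coalgebra.Repr k g ι)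
    (t : (tensorPow V (n + 2)).carrier) :
    ∑ i ∈ r.index, (tensorPow V (n + 1)).ρ (r.left i) (contractHead V n (l ∘ₗ θ.symm.toLinearMap)
      ((tensorPow V (n + 2)).ρ (antipode k (r.right i)) t)) =
      contractHead V n (l ∘ₗ LinearMap.mulLeft k (antipode k g) ∘ₗ θ.symm.toLinearMap) t := by
  let F : (tensorPow V (n + 2)).carrier →ₗ[k] (tensorPow V (n + 1)).carrier :=
    ∑ i ∈ r.index, (tensorPow V (n + 1)).ρ (r.left i) ∘ₗ
      contractHead V n (l ∘ₗ θ.symm.toLinearMap) ∘ₗ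
        (tensorPow V (n + 2)).ρ (antipode k (r.right i))
  suffices h : F = contractHead V n
      (l ∘ₗ LinearMap.mulLeft k (antipode k g) ∘ₗ θ.symm.toLinearMap) by
    rw [← h]
    simp [F]
  refine tensorPow_hom_ext fun v w => ?_
  obtain ⟨y, rfl⟩ := θ.surjective v
  have h1 : ∀ i, (tensorPow V (n + 2)).ρ (antipode k (r.right i)) (consHead V n (θ y) w) =
      ∑ m ∈ (ℛ k (r.right i)).index, consHead V n
        (θ (antipode k ((ℛ k (r.right i)).right m) * y))
        ((tensorPow V (n + 1)).ρ (antipode k ((ℛ k (r.right i)).left m)) w) := fun i => by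
    rw [tensorPow_ρ_consHead V n (antipode k (r.right i))
      ⟨(ℛ k (r.right i)).index, fun m => antipode k ((ℛ k (r.right i)).right m),
        fun m => antipode k ((ℛ k (r.right i)).left m), (comul_antipode _).symm⟩]
    simp only [hθ]
  have key := Coalgebra.sum_tmul_tmul_eq r (fun i => ℛ k (r.left i)) (fun i => ℛ k (r.right i))
  have key2 := congrArg ((TensorProduct.rid k _).toLinearMap ∘ₗ TensorProduct.map
    ((LinearMap.applyₗ w ∘ₗ (tensorPow V (n + 1)).ρ.toLinearMap) ∘ₗ LinearMap.mul' k H ∘ₗ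
      (antipode k).lTensor H) (l ∘ₗ LinearMap.mulRight k y ∘ₗ antipode k) ∘ₗ
      (TensorProduct.assoc k H H H).symm.toLinearMap) key
  have key3 : ∀ i, ∑ j ∈ (ℛ k (r.left i)).index, (tensorPow V (n + 1)).ρ
      ((ℛ k (r.left i)).left j) ((tensorPow V (n + 1)).ρ
        (antipode k ((ℛ k (r.left i)).right j)) w) = counit (R := k) (r.left i) • w := fun i => by
    have := congrArg (fun a => (tensorPow V (n + 1)).ρ a w)
      (sum_mul_antipode_eq_smul (R := k) (ℛ k (r.left i)))
    simpa using this
  simp [← Finset.smul_sum, key3, smul_smul] at key2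
  simp [F, h1, contractHead_consHead]
  rw [← key2, ← Finset.sum_smul]
  congr 1
  conv_rhs => rw [← Coalgebra.sum_counit_smul r]
  simp [Finset.sum_mul, mul_comm]

/-- The dual bases $\Lambda_1$ and $l(S(\Lambda_2)\,\cdot\,)$ applied to the first tensor factor. -/
theorem sum_consHead_contractHead (hl : IsIntegralPair Λ l) [FiniteDimensional k H]
    {ι : Type*} (r : Coalgebra.Repr k Λ ι) (t : (tensorPow V (n + 2)).carrier) :
    ∑ i ∈ r.index, consHead V n (θ (r.left i)) (contractHead V n
      (l ∘ₗ LinearMap.mulLeft k (antipode k (r.right i)) ∘ₗ θ.symm.toLinearMap) t) = t := by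
  let F : (tensorPow V (n + 2)).carrier →ₗ[k] (tensorPow V (n + 2)).carrier :=
    ∑ i ∈ r.index, consHead V n (θ (r.left i)) ∘ₗ contractHead V n
      (l ∘ₗ LinearMap.mulLeft k (antipode k (r.right i)) ∘ₗ θ.symm.toLinearMap)
  suffices h : F = LinearMap.id by
    refine Eq.trans ?_ (LinearMap.congr_fun h t)
    simp [F]
  refine tensorPow_hom_ext fun v w => ?_
  obtain ⟨y, rfl⟩ := θ.surjective v
  have h1 := congrArg (fun x => consHead V n (θ x) w) (hl.sum_apply_antipode_mul_smul r y)
  simp only [F, LinearMap.sum_apply, LinearMap.comp_apply, contractHead_consHead]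
  refine Eq.trans ?_ h1
  simp

end HMod
end NegativeIndicator

/-! ### Traces of inverse rotations on objects modelled on the regular module. -/

section NegativeIndicatorTrace

open TensorProduct Coalgebra HopfAlgebra FSIndicator.HMod

variable {k H : Type u} [Field k] [Ring H] [HopfAlgebra k H]

namespace HMod

theorem trace_indicatorMap_succ_symm (V : PivotalObject (HMod k H)) (n : ℕ)
    (e : (tensorPow V.obj (n + 1)).carrier ≃ₗ[k] (𝟙_ (HMod k H) ⟶ tensorPow V.obj (n + 2)))
    (ξ ζ : Module.Dual k V.obj.carrier) (hζ : ∀ v, ζ (pivotMap V v) = ξ v)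
    (he : ∀ f, e.symm f = contractHead V.obj n ξ (unitValue _ f)) :
    LinearMap.trace k (𝟙_ (HMod k H) ⟶ tensorPow V.obj (n + 2))
      (indicatorMap k V (n + 1)).symm.toLinearMap =
      LinearMap.trace k _ (contractTail V.obj n ζ ∘ₗ
        unitValue (tensorPow V.obj (n + 2)) ∘ₗ e.toLinearMap) := by
  obtain rfl : ζ ∘ₗ pivotMap V = ξ := LinearMap.ext hζ
  rw [← LinearMap.trace_conj' _ e.symm]
  congr 1
  refine LinearMap.ext fun w => ?_
  refine (he ((indicatorMap k V (n + 1)).symm (e w))).trans ?_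
  have h1 := contractTail_unitValue_indicatorMap V n ζ ((indicatorMap k V (n + 1)).symm (e w))
  have h2 := (indicatorMap k V (n + 1)).apply_symm_apply (e w)
  refine h1.symm.trans ?_
  exact congrArg (fun g => contractTail V.obj n ζ (unitValue (tensorPow V.obj (n + 2)) g)) h2

variable [FiniteDimensional k H] {V : HMod k H} {Λ : H} {l : Module.Dual k H}

/-- For `V` isomorphic to the regular module, the invariants of `V^{⊗(n+2)}` are the elements
`Λ₁ ⊗ Λ₂w` with `w` in `V^{⊗(n+1)}`. -/
def invariantsRegularEquiv (hl : IsIntegralPair Λ l) (θ : H ≃ₗ[k] V.carrier)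
    (hθ : ∀ a x, θ (a * x) = V.ρ a (θ x)) (n : ℕ) :
    (tensorPow V (n + 1)).carrier ≃ₗ[k] (𝟙_ (HMod k H) ⟶ tensorPow V (n + 2)) :=
  unitHomEquiv ((consAction θ n).flip (comul Λ)) (contractHead V n (l ∘ₗ θ.symm.toLinearMap))
    (fun w h => by
      rw [LinearMap.flip_apply, ρ_consAction θ hθ, ← Bialgebra.comul_mul, hl.mul_eq, map_smul,
        map_smul])
    (fun w => by
      have h1 : sliceComul Λ l = 1 := by rw [hl.sliceComul_eq, hl.apply_eq, one_smul]
      have h2 := congrArg (fun a => (tensorPow V (n + 1)).ρ a w) h1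
      simp only [sliceComul_eq_sum (ℛ k Λ), map_sum, map_smul, map_one, LinearMap.sum_apply,
        LinearMap.smul_apply, Module.End.one_apply] at h2
      rw [← (ℛ k Λ).eq]
      simpa [consAction_tmul, contractHead_consHead] using h2)
    (fun f => by
      -- On an invariant $S(g_2)$ acts by $\varepsilon(g_2)$, so the action of $g$ moves into the
      -- contracting functional. Taking $g=\Lambda_2$ then reconstructs the invariant from its
      -- contraction.
      have h1 : ∀ g, (tensorPow V (n + 1)).ρ g
          (contractHead V n (l ∘ₗ θ.symm.toLinearMap) (unitValue _ f)) =
          contractHead V n (l ∘ₗ LinearMap.mulLeft k (antipode k g) ∘ₗ θ.symm.toLinearMap)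
            (unitValue _ f) := fun g => by
        rw [← ρ_contractHead_ρ_antipode θ hθ g (ℛ k g)]
        conv_lhs => rw [← sum_counit_right_smul (ℛ k g)]
        simp [ρ_unitValue]
      rw [LinearMap.flip_apply, ← (ℛ k Λ).eq]
      simp only [map_sum, consAction_tmul, h1]
      exact sum_consHead_contractHead θ hl (ℛ k Λ) _)

/-- Hypothesis `hψ` says that $\psi$ is $S^{-2}$ through $\theta$. Undoing the rotation thus
replaces $l$ by $l\circ S^2$, and both traces equal $l(S^2(\Lambda_{n+2}\cdots\Lambda_1))$. -/
theorem trace_indicatorMap_succ_symm_of_regular (V : PivotalObject (HMod k H)) (n : ℕ)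
    (θ : H ≃ₗ[k] V.obj.carrier) (hθ : ∀ a x, θ (a * x) = V.obj.ρ a (θ x))
    (hψ : ∀ x, pivotMap V (θ (antipode k (antipode k x))) = θ x) :
    LinearMap.trace k (𝟙_ (HMod k H) ⟶ tensorPow V.obj (n + 2))
      (indicatorMap k V (n + 1)).symm.toLinearMap =
      LinearMap.trace k H (antipode k ∘ₗ
        ((WithConv.toConv (antipode k) : WithConv (H →ₗ[k] H)) ^ (n + 3)).ofConv) := by
  obtain ⟨Λ, l, hl⟩ := exists_isIntegralPair (k := k) (H := H)
  let ζ : Module.Dual k V.obj.carrier := l ∘ₗ antipode k ∘ₗ antipode k ∘ₗ θ.symm.toLinearMap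
  rw [trace_indicatorMap_succ_symm V n (invariantsRegularEquiv hl θ hθ n)
    (l ∘ₗ θ.symm.toLinearMap) ζ ?_ fun f => rfl]
  · have h1 : contractTail V.obj n ζ ∘ₗ unitValue (tensorPow V.obj (n + 2)) ∘ₗ
        (invariantsRegularEquiv hl θ hθ n).toLinearMap =
        ∑ i ∈ (ℛ k Λ).index, contractTail V.obj n ζ ∘ₗ consHead V.obj n (θ ((ℛ k Λ).left i)) ∘ₗ
          (tensorPow V.obj (n + 1)).ρ ((ℛ k Λ).right i) := by
      refine LinearMap.ext fun w => ?_
      have h2 : unitValue _ (invariantsRegularEquiv hl θ hθ n w) =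
          consAction θ n w (comul Λ) := one_smul k _
      rw [← (ℛ k Λ).eq] at h2
      simp only [LinearMap.comp_apply, LinearEquiv.coe_coe, h2, LinearMap.sum_apply, map_sum,
        consAction_tmul]
    rw [h1, map_sum, hl.trace_antipode_comp_pow, ← antipode_antipode_opConvPow (n + 1),
      opConvPow_succ_apply n (ℛ k Λ)]
    simp only [trace_contractTail_consHead, map_sum]
    refine Finset.sum_congr rfl fun i _ => ?_
    simp [ζ, ← hθ]
  · intro v
    obtain ⟨x, rfl⟩ := θ.surjective v
    obtain ⟨x, rfl⟩ := (antipode_bijective (k := k)).2 x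
    obtain ⟨x, rfl⟩ := (antipode_bijective (k := k)).2 x
    rw [hψ]
    simp [ζ]

/-- For `V` isomorphic to the regular module, the invariants of `V` are spanned by the left
integral. -/
def invariantsRegularEquivZero (hl : IsIntegralPair Λ l) (θ : H ≃ₗ[k] V.carrier)
    (hθ : ∀ a x, θ (a * x) = V.ρ a (θ x)) : k ≃ₗ[k] (𝟙_ (HMod k H) ⟶ V) :=
  unitHomEquiv (LinearMap.toSpanSingleton k _ (θ Λ)) (l ∘ₗ θ.symm.toLinearMap)
    (fun c h => by
      rw [LinearMap.toSpanSingleton_apply, map_smul, ← hθ, hl.mul_eq, map_smul, smul_comm])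
    (fun c => by simp [hl.apply_eq])
    (fun f => by
      obtain ⟨y, hy⟩ := θ.surjective (unitValue V f)
      have h1 : ∀ g, g * y = counit (R := k) g • y := fun g => θ.injective (by
        rw [hθ, hy, ρ_unitValue, map_smul, hy])
      -- For invariant $y$, $S(\Lambda_2)y=\varepsilon(\Lambda_2)y$, so the dual basis expansion
      -- reads $y=l(y)\Lambda$.
      have h2 := hl.sum_apply_antipode_mul_smul (ℛ k Λ) y
      simp only [h1, counit_antipode, map_smul, smul_eq_mul, mul_comm _ (l y), mul_smul,
        ← Finset.smul_sum, sum_counit_right_smul] at h2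
      rw [← hy, LinearMap.comp_apply, LinearEquiv.coe_coe, LinearEquiv.symm_apply_apply,
        LinearMap.toSpanSingleton_apply, ← map_smul, h2])

theorem trace_eq_symm_apply {M : Type*} [AddCommGroup M] [Module k M] (e : k ≃ₗ[k] M)
    (f : M →ₗ[k] M) : LinearMap.trace k M f = e.symm (f (e 1)) := by
  rw [← LinearMap.trace_conj' f e.symm]
  have h1 : e.symm.conj f = (LinearMap.id : k →ₗ[k] k).smulRight (e.symm (f (e 1))) := by
    ext
    simp
  rw [h1, LinearMap.trace_smulRight]
  rfl

theorem trace_indicatorMap_zero_symm_of_regular (V : PivotalObject (HMod k H))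
    (θ : H ≃ₗ[k] V.obj.carrier) (hθ : ∀ a x, θ (a * x) = V.obj.ρ a (θ x))
    (hψ : ∀ x, pivotMap V (θ (antipode k (antipode k x))) = θ x) :
    LinearMap.trace k (𝟙_ (HMod k H) ⟶ tensorPow V.obj 1)
      (indicatorMap k V 0).symm.toLinearMap =
      LinearMap.trace k H (antipode k ∘ₗ
        ((WithConv.toConv (antipode k) : WithConv (H →ₗ[k] H)) ^ 2).ofConv) := by
  obtain ⟨Λ, l, hl⟩ := exists_isIntegralPair (k := k) (H := H)
  let e : k ≃ₗ[k] (𝟙_ (HMod k H) ⟶ tensorPow V.obj 1) := invariantsRegularEquivZero hl θ hθ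
  rw [trace_eq_symm_apply e, hl.trace_antipode_comp_pow 1]
  let f : 𝟙_ (HMod k H) ⟶ tensorPow V.obj 1 := (indicatorMap k V 0).symm (e 1)
  change l (θ.symm (unitValue V.obj f)) = _
  have h1 : pivotMap V (unitValue V.obj f) = θ Λ := by
    refine (lin_indicatorMap_zero_one V f).symm.trans ?_
    rw [LinearEquiv.apply_symm_apply]
    exact (one_smul k ((1 : k) • θ Λ)).trans (one_smul k (θ Λ))
  obtain ⟨x, hx⟩ := θ.surjective (unitValue V.obj f)
  obtain ⟨x, rfl⟩ := (antipode_bijective (k := k)).2 x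
  obtain ⟨x, rfl⟩ := (antipode_bijective (k := k)).2 x
  rw [← hx, hψ] at h1
  rw [← hx, θ.injective h1]
  simp

end HMod
end NegativeIndicatorTrace

/-! ### Low indices, and the comparison for all integers. -/

section RegularIndicator

open TensorProduct Coalgebra HopfAlgebra FSIndicator.HMod

variable (k H : Type u) [Field k] [Ring H] [HopfAlgebra k H]

theorem convId_pow (n : ℕ) : ((convId k H ^ n : (WithConv (H →ₗ[k] H))ˣ) : WithConv (H →ₗ[k] H)) =
    (WithConv.toConv LinearMap.id) ^ n := Units.val_pow_eq_pow_val _ _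

theorem convId_inv_pow (n : ℕ) :
    (((convId k H)⁻¹ ^ n : (WithConv (H →ₗ[k] H))ˣ) : WithConv (H →ₗ[k] H)) =
      (WithConv.toConv (antipode k)) ^ n := Units.val_pow_eq_pow_val _ _

theorem trace_indicatorMapZero (V : PivotalObject (HMod k H)) :
    LinearMap.trace k (𝟙_ (HMod k H) ⟶ 𝟙_ (HMod k H)) (indicatorMapZero k V) =
      LinearMap.trace k V.obj.carrier (pivotMap V) := by
  let e : k ≃ₗ[k] (𝟙_ (HMod k H) ⟶ 𝟙_ (HMod k H)) :=
    unitHomEquiv (V := 𝟙_ (HMod k H)) LinearMap.id LinearMap.id (fun m h => rfl)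
      (fun m => rfl) (fun f => rfl)
  rw [trace_eq_symm_apply e, ← lin_leftDim_one]
  change lin (leftDim V) (lin (e 1) (1 : k)) = _
  have h1 : lin (e 1) (1 : k) = (1 : k) := one_smul k (1 : k)
  rw [h1]

variable [FiniteDimensional k H]

/-- Dualizing twice returns the transpose of $\phi^{-1}$, which undoes the $S^2$ in $\phi$. This is
the hypothesis on $\psi$ needed for negative indices. -/
theorem pivotMap_dual_dual_regularPivotal (x : H) :
    pivotMap (regularPivotal k H).dual.dual (regularEquiv k H (antipode k (antipode k x))) =
      regularEquiv k H x := by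
  refine (lin_dualMap_apply (dualMap (regularPivotal k H).φ.inv) _).trans ?_
  refine LinearMap.ext fun p => ?_
  have h1 := lin_dualMap_apply (regularPivotal k H).φ.inv p
  refine (congrArg (fun q : Module.Dual k (Module.Dual k (Module.Dual k H)) =>
    q (regularEquiv k H (antipode k (antipode k x)))) h1).trans ?_
  change @DFunLike.coe (Module.Dual k H) _ _ _ p
    ((regularEquiv k H).symm (regularEquiv k H (antipode k (antipode k x)))) = _
  rw [LinearEquiv.symm_apply_apply]
  rfl

theorem regularEquiv_mul (a x : H) : regularEquiv k H (a * x) =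
    (regularPivotal k H).dual.dual.obj.ρ a (regularEquiv k H x) :=
  LinearMap.congr_fun (regularEquiv_comm k H a) x

/-- The invariants of the dual of the regular module are spanned by the counit. -/
def invariantsDualRegularEquivZero :
    k ≃ₗ[k] (𝟙_ (HMod k H) ⟶ tensorPow (dual (regular k H)) 1) :=
  unitHomEquiv (V := dual (regular k H))
    (LinearMap.toSpanSingleton k (Module.Dual k H) (counit (R := k) (A := H)))
    (evalOne (H := H))
    (fun c h => LinearMap.ext fun x : H => by
      change c * counit (R := k) (antipode k h * x) = counit (R := k) h * (c * counit (R := k) x)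
      rw [Bialgebra.counit_mul, counit_antipode, mul_left_comm])
    (fun c => by
      change c * counit (R := k) (1 : H) = c
      rw [Bialgebra.counit_one, mul_one])
    (fun f => by
      let p : Module.Dual k H := unitValue (dual (regular k H)) f
      refine LinearMap.ext fun x : H => ?_
      change p 1 * counit (R := k) x = p x
      obtain ⟨x, rfl⟩ := (antipode_bijective (k := k)).2 x
      have h1 : p (antipode k x * 1) = counit (R := k) x * p 1 :=
        congrArg (fun q : Module.Dual k H => q 1) (ρ_unitValue f x)
      rw [counit_antipode, mul_comm, ← h1, mul_one])

theorem trace_indicatorMap_zero_dual_regularPivotal :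
    LinearMap.trace k (𝟙_ (HMod k H) ⟶ tensorPow (dual (regular k H)) 1)
      (indicatorMap k (regularPivotal k H).dual 0).toLinearMap = 1 := by
  refine (trace_eq_symm_apply (invariantsDualRegularEquivZero k H)
    (indicatorMap k (regularPivotal k H).dual 0).toLinearMap).trans ?_
  let f := invariantsDualRegularEquivZero k H 1
  change evalOne (H := H) (unitValue (dual (regular k H))
    (indicatorMap k (regularPivotal k H).dual 0 f)) = 1
  have h1 := lin_indicatorMap_zero_one (regularPivotal k H).dual f
  have h2 : evalOne (H := H) (unitValue (dual (regular k H)) f) = 1 :=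
    (invariantsDualRegularEquivZero k H).symm_apply_apply 1
  exact (congrArg (evalOne (H := H)) h1).trans ((evalOne_pivotMap _).trans h2)

theorem trace_pivotMap_dual_regularPivotal :
    LinearMap.trace k (dual (regular k H)).carrier (pivotMap (regularPivotal k H).dual) =
      LinearMap.trace k H (antipode k ∘ₗ antipode k) := by
  have h1 : pivotMap (regularPivotal k H).dual =
      Module.Dual.transpose (antipode k ∘ₗ antipode k : H →ₗ[k] H) :=
    LinearMap.ext fun p => pivotMap_dual_regularPivotal (H := H) p
  exact (congrArg (LinearMap.trace k (Module.Dual k H)) h1).trans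
    (LinearMap.trace_transpose' _)

/-- The Kashina-Montgomery-Ng indicators of `H` are the indicators of the dual of the regular
pivotal object. -/
theorem kmnIndicator_eq_indicator (n : ℤ) :
    kmnIndicator k H n = indicator k n 1 (regularPivotal k H).dual := by
  match n with
  | .ofNat 0 =>
    have h1 : indicator k (.ofNat 0) 1 (regularPivotal k H).dual =
        LinearMap.trace k _ (indicatorMapZero k (regularPivotal k H).dual) := by
      simp [indicator]
    rw [h1, trace_indicatorMapZero]
    refine Eq.trans ?_ (trace_pivotMap_dual_regularPivotal k H).symm
    rw [kmnIndicator, show (Int.ofNat 0 - 1 : ℤ) = -1 from rfl, zpow_neg_one]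
    rfl
  | .ofNat 1 =>
    have h1 : indicator k (.ofNat 1) 1 (regularPivotal k H).dual =
        LinearMap.trace k _ (indicatorMap k (regularPivotal k H).dual 0).toLinearMap := by
      simp only [indicator, zpow_one]
    refine Eq.trans ?_ (h1.trans (trace_indicatorMap_zero_dual_regularPivotal k H)).symm
    rw [kmnIndicator, show (Int.ofNat 1 - 1 : ℤ) = 0 from rfl, zpow_zero]
    have h2 : antipode k ∘ₗ ((1 : (WithConv (H →ₗ[k] H))ˣ) : WithConv (H →ₗ[k] H)).ofConv =
        (counit (R := k) (A := H)).smulRight (1 : H) := by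
      ext x
      simp [LinearMap.convOne_def, Algebra.algebraMap_eq_smul_one]
    rw [h2, LinearMap.trace_smulRight, Bialgebra.counit_one]
  | .ofNat (m + 2) =>
    have h1 : indicator k (.ofNat (m + 2)) 1 (regularPivotal k H).dual =
        LinearMap.trace k _ (indicatorMap k (regularPivotal k H).dual (m + 1)).toLinearMap := by
      simp only [indicator, zpow_one]
    refine Eq.trans ?_ (h1.trans (trace_indicatorMap_succ_dual_regularPivotal m)).symm
    rw [kmnIndicator, show (Int.ofNat (m + 2) - 1 : ℤ) = ((m + 1 : ℕ) : ℤ) by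
      simp; ring, zpow_natCast, convId_pow]
  | .negSucc m =>
    have h1 : indicator k (.negSucc m) 1 (regularPivotal k H).dual =
        LinearMap.trace k _ (indicatorMap k (regularPivotal k H).dual.dual m).symm.toLinearMap := by
      simp only [indicator, zpow_neg_one]
      rfl
    have h2 : kmnIndicator k H (.negSucc m) = LinearMap.trace k H (antipode k ∘ₗ
        ((WithConv.toConv (antipode k) : WithConv (H →ₗ[k] H)) ^ (m + 2)).ofConv) := by
      -- `Int.negSucc m` is $-(m+1)$, so the exponent $n-1$ is $-(m+2)$ and the convolution power is
      -- $S^{\star(m+2)}$.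
      rw [kmnIndicator, show (Int.negSucc m - 1 : ℤ) = -((m + 2 : ℕ) : ℤ) by
        rw [Int.negSucc_eq]; push_cast; ring, zpow_neg, ← inv_zpow, zpow_natCast, convId_inv_pow]
    rw [h2]
    refine Eq.trans ?_ h1.symm
    cases m with
    | zero =>
      exact (trace_indicatorMap_zero_symm_of_regular _ (regularEquiv k H) (regularEquiv_mul k H)
        (pivotMap_dual_dual_regularPivotal k H)).symm
    | succ m =>
      exact (trace_indicatorMap_succ_symm_of_regular _ m (regularEquiv k H) (regularEquiv_mul k H)
        (pivotMap_dual_dual_regularPivotal k H)).symm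

end RegularIndicator

end FSIndicator

end

theorem mainTheorem5 {k H : Type u} [Field k] [Ring H] [HopfAlgebra k H]
    [FiniteDimensional k H] (n : ℤ) :
    FSIndicator.kmnIndicator k H n =
      FSIndicator.indicator k n 1 (FSIndicator.regularPivotal k H).dual :=
  FSIndicator.kmnIndicator_eq_indicator k H n
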